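/- Let $r_0>0$, let $B_R\subset\mathbb R^2$ be the open disc of radius $R$ centred at the origin, and write $r=|x|$. For every $\epsilon>0$ the Dirichlet problem $$\Delta u=4\pi^2\epsilon^{-2}\left(e^{2u}-r^2e^{-2u}\right)\ \text{ in } B_{2r_0},\qquad u=\tfrac12\ln(2r_0)\ \text{ on } \partial B_{2r_0},$$ has a solution $u_\epsilon$ that is smooth on the closed disc $\overline{B_{2r_0}}$ and radially symmetric, and it is the only solution in $C^2(B_{2r_0})\cap C^0(\overline{B_{2r_0}})$ (in particular, the only smooth one). Writing $u_\epsilon(r)$ for the value of $u_\epsilon$ at radius $r$, the solutions satisfy the following estimates. (1) Let $v_\epsilon(r)=u_\epsilon(r)-\frac12\ln r$ for $r\in[r_0,2r_0]$. For all integers $l>k\ge 0$ there is a constant $C=C(r_0,l,k)$ such that for every $0<\epsilon<1/8$ $$\|v_\epsilon^{(k)}\|_{C^0([r_0,2r_0])}<C\,\epsilon^{\,l-k},$$ where $v_\epsilon^{(k)}$ is the $k$-th derivative of $v_\epsilon$ in $r$ (one-sided at the endpoints). (2) For every integer $k\ge 0$ and every $0<R\le 2r_0$ there is a constant $C=C(r_0,R,k)$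 such that for every $0<\epsilon<1/8$ $$\|u_\epsilon\|_{C^k(B_R)}\le C\,\epsilon^{-k-2},$$ where $\|u\|_{C^k(\Omega)}=\sum_{j=0}^k\max_{|\beta|=j}\sup_{\Omega}|D^\beta u|$. -/

import Mathlib

open scoped ContDiff Laplacian

/-- The Euclidean plane. -/
abbrev Plane : Type := EuclideanSpace ℝ (Fin 2)

/-- The supremum of `|f|` over `S`, with value in `[0, ∞]`. -/
noncomputable def supNormOn {X : Type*} (S : Set X) (f : X → ℝ) : ENNReal :=
  ⨆ x ∈ S, ‖f x‖ₑ

/-- The `C^k` norm `∑_{j ≤ k} max_{|β| = j} sup_Ω |D^β u|` on an open set `Ω` of the plane, with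
value in `[0, ∞]`. The word `s` lists the coordinate directions of the partial derivative
`∂_{s 0} ⋯ ∂_{s (j-1)}` of order `j`. -/
noncomputable def ckNorm (k : ℕ) (Ω : Set Plane) (u : Plane → ℝ) : ENNReal :=
  ∑ j ∈ Finset.range (k + 1), ⨆ s : Fin j → Fin 2,
    supNormOn Ω fun x => iteratedFDeriv ℝ j u x fun m => EuclideanSpace.single (s m) (1 : ℝ)

/-- `u` is a classical solution of the Dirichlet problem
`Δ u = 4 π² ε⁻² (exp (2 u) - r² exp (-2 u))` in the disc of radius `2 r₀`, with
`u = (1/2) log (2 r₀)` on the boundary circle. Values of `u` off the closed disc play no role. -/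
structure IsClassicalSolution (r₀ ε : ℝ) (u : Plane → ℝ) : Prop where
  contDiffOn : ContDiffOn ℝ 2 u (Metric.ball 0 (2 * r₀))
  continuousOn : ContinuousOn u (Metric.closedBall 0 (2 * r₀))
  equation : ∀ x ∈ Metric.ball (0 : Plane) (2 * r₀),
    Δ u x = 4 * Real.pi ^ 2 * (ε ^ 2)⁻¹ *
      (Real.exp (2 * u x) - ‖x‖ ^ 2 * Real.exp (-2 * u x))
  boundary : ∀ x ∈ Metric.sphere (0 : Plane) (2 * r₀), u x = 1 / 2 * Real.log (2 * r₀)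

/-- `u` is radially symmetric on `S`: on `S` it depends on `‖x‖` only. -/
def IsRadialOn (u : Plane → ℝ) (S : Set Plane) : Prop :=
  ∀ x ∈ S, ∀ y ∈ S, ‖x‖ = ‖y‖ → u x = u y

/-- The value at radius `r ≥ 0` of a radially symmetric function, read off on the first axis. -/
noncomputable def radialProfile (u : Plane → ℝ) (r : ℝ) : ℝ :=
  u (EuclideanSpace.single 0 r)

/-- The difference `v (r) = u (r) - (1/2) log r` from the singular solution. -/
noncomputable def radialDifference (u : Plane → ℝ) (r : ℝ) : ℝ :=
  radialProfile u r - 1 / 2 * Real.log r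

/-!
A radial solution is written `u (x) = g (|x|²)`. In the variable `t = r² ∈ [0, T]`, `T = (2 r₀)²`,
the equation becomes `(t g')' = f`, where `f = π² ε⁻² (e^{2g} - t e^{-2g})`, with
`g T = (1/4) log T`; regularity at the origin means `g' = ∫₀¹ f (t θ) dθ`.

*Existence and uniqueness.* The nonlinearity is replaced by a bounded, nonnegative, Lipschitz one.
The initial value problem `g 0 = a` is then solved by a contraction in a weighted supremum norm
(`exists_solution_initialValue`), and the intermediate value theorem provides the `a` that meets
the boundary value (`exists_cut_solution`). Since `t g'` increases, the solution lies between
`(1/4) log t` and `(1/4) log T`, where the replacement changes nothing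
(`isProfile_of_cut_solution`). Smoothness up to both ends follows by bootstrapping the formula for
`g'`, as means over `[0, t]` preserve `Cⁿ`. Uniqueness, among all classical solutions, is the
maximum principle: the nonlinearity increases with `u` (`IsClassicalSolution.le`).

*Bounds for the derivatives.* The energy `t g'² - π² ε⁻² e^{2g}` is nonincreasing, which gives
`|u'| = O(ε⁻¹)`. Moreover `e^{-2u} = O(1 / m)` with `m = max(r, ε)`. By induction on `i`, the
differentiated equation `t g⁽ⁱ⁺¹⁾ + i g⁽ⁱ⁾ = f⁽ⁱ⁻¹⁾` then yields `g⁽ⁱ⁾ = O((ε m)⁻ⁱ)`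
(`exists_iteratedDerivWithin_profile_le`). The chain rule for `g (|x|²)`, at the scale `ε m`, turns
this and `u = O(ε⁻²)` into the `Cᵏ` bound (`exists_norm_iteratedFDeriv_profile_le`).

*Decay near the boundary.* The difference `V = g - (1/4) log t` is nonnegative, at most `1` at
`t = T / 16`, zero at `T`, and satisfies `(t V')' ≥ const ε⁻² V`. An exponential barrier shows that
it is `O(εᴺ)` for every `N` when `t ≥ T / 4` (`exists_profileDiff_le`). As its derivatives grow at
most like powers of `ε⁻¹`, Landau's interpolation inequality makes them `O(εᴺ)` as well
(`exists_iteratedDerivWithin_profileDiff_le`).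
-/

open Set Filter Topology
open scoped BoundedContinuousFunction NNReal

/-! ### Calculus on the line and moment means -/

/-- With `f'' > 0` the point would be a local minimum as well, and `f` locally constant. -/
lemma second_deriv_nonpos_of_isLocalMax {f f' : ℝ → ℝ} {f'' x : ℝ}
    (hf : ∀ᶠ y in 𝓝 x, HasDerivAt f (f' y) y) (hf' : HasDerivAt f' f'' x)
    (h : IsLocalMax f x) : f'' ≤ 0 := by
  by_contra! hpos
  have hd : deriv f =ᶠ[𝓝 x] f' := hf.mono fun y hy => hy.deriv
  have hdd : deriv (deriv f) x = f'' := by rw [hd.deriv_eq, hf'.deriv]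
  have hmin : IsLocalMin f x :=
    isLocalMin_of_deriv_deriv_pos (by rw [hdd]; exact hpos) h.deriv_eq_zero
      hf.self_of_nhds.continuousAt
  have hconst : f =ᶠ[𝓝 x] fun _ => f x := by
    filter_upwards [h, hmin] with y h1 h2 using le_antisymm h1 h2
  have : deriv (deriv f) x = 0 := by
    rw [hconst.deriv.deriv_eq]; simp
  linarith

/-- A `Cⁿ` function on a compact interval is the restriction of a `Cⁿ` function on the line: extend
the `n`-th derivative by constants and integrate back. -/
lemma exists_contDiff_eqOn_Icc {a b : ℝ} (hab : a < b) (n : ℕ) {f : ℝ → ℝ}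
    (hf : ContDiffOn ℝ n f (Icc a b)) : ∃ F : ℝ → ℝ, ContDiff ℝ n F ∧ EqOn F f (Icc a b) := by
  induction n generalizing f with
  | zero =>
    refine ⟨IccExtend hab.le ((Icc a b).domRestrict f), ?_, fun x hx => ?_⟩
    · have := (continuousOn_iff_continuous_domRestrict.1 hf.continuousOn).Icc_extend' (h := hab.le)
      exact contDiff_zero.2 this
    · rw [IccExtend_of_mem _ _ hx]; rfl
  | succ n ih =>
    have hu := uniqueDiffOn_Icc hab
    have hf' := (contDiffOn_succ_iff_derivWithin (n := (n : ℕ∞ω)) hu).1 (by exact_mod_cast hf)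
    obtain ⟨D, hD, hDe⟩ := ih hf'.2.2
    have hder : ∀ x, HasDerivAt (fun x => f a + ∫ y in a..x, D y) (D x) x := fun x =>
      ((hD.continuous.integral_hasStrictDerivAt a x).hasDerivAt).const_add _
    refine ⟨fun x => f a + ∫ y in a..x, D y, ?_, fun x hx => ?_⟩
    · have : ContDiff ℝ ((n : ℕ∞ω) + 1) fun x => f a + ∫ y in a..x, D y := by
        rw [contDiff_succ_iff_deriv]
        refine ⟨fun x => (hder x).differentiableAt, by simp, ?_⟩
        rwa [show deriv (fun x => f a + ∫ y in a..x, D y) = D from funext fun x => (hder x).deriv]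
      exact_mod_cast this
    · have h1 : ∫ y in a..x, D y = f x - f a := by
        refine intervalIntegral.integral_eq_sub_of_hasDerivAt_of_le hx.1
          (hf.continuousOn.mono (Icc_subset_Icc_right hx.2)) (fun y hy => ?_)
          (hD.continuous.intervalIntegrable _ _)
        have hy' : y ∈ Ioo a b := ⟨hy.1, hy.2.trans_le hx.2⟩
        rw [hDe (Ioo_subset_Icc_self hy')]
        exact (hf'.1 y (Ioo_subset_Icc_self hy')).hasDerivWithinAt.hasDerivAt
          (Icc_mem_nhds hy'.1 hy'.2)
      simp [h1]

/-- The weighted mean `∫₀¹ θᵏ f (t θ) dθ` of `f` over the segment from `0` to `t`. -/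
noncomputable def momentMean (k : ℕ) (f : ℝ → ℝ) (t : ℝ) : ℝ :=
  ∫ θ in (0 : ℝ)..1, θ ^ k * f (t * θ)

lemma momentMean_congr {k : ℕ} {f g : ℝ → ℝ} {T t : ℝ} (h : EqOn f g (Icc 0 T))
    (ht : t ∈ Icc 0 T) : momentMean k f t = momentMean k g t := by
  refine intervalIntegral.integral_congr fun θ hθ => ?_
  rw [uIcc_of_le zero_le_one] at hθ
  have : t * θ ∈ Icc 0 T := ⟨mul_nonneg ht.1 hθ.1, (mul_le_of_le_one_right ht.1 hθ.2).trans ht.2⟩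
  simp only [h this]

lemma abs_momentMean_le {k : ℕ} {f : ℝ → ℝ} {t B : ℝ} (ht : 0 ≤ t)
    (hB : ∀ s ∈ Icc 0 t, |f s| ≤ B) : |momentMean k f t| ≤ B := by
  have := intervalIntegral.norm_integral_le_of_norm_le_const (a := 0) (b := 1)
    (f := fun θ : ℝ => θ ^ k * f (t * θ)) (C := B) fun θ hθ => ?_
  · simpa [momentMean] using this
  rw [uIoc_of_le zero_le_one] at hθ
  have h1 : |f (t * θ)| ≤ B := hB _ ⟨mul_nonneg ht hθ.1.le, mul_le_of_le_one_right ht hθ.2⟩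
  have h2 : |θ ^ k| ≤ 1 := by
    rw [abs_of_nonneg (pow_nonneg hθ.1.le k)]; exact pow_le_one₀ hθ.1.le hθ.2
  rw [Real.norm_eq_abs, abs_mul]
  calc |θ ^ k| * |f (t * θ)| ≤ 1 * B := by gcongr
    _ = B := one_mul B

lemma continuous_momentMean {k : ℕ} {f : ℝ → ℝ} (hf : Continuous f) :
    Continuous (momentMean k f) := by
  unfold momentMean
  exact intervalIntegral.continuous_parametric_intervalIntegral_of_continuous' (by fun_prop) 0 1

lemma hasDerivAt_momentMean {k : ℕ} {f f' : ℝ → ℝ} (hf : ∀ x, HasDerivAt f (f' x) x)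
    (hf' : Continuous f') (t : ℝ) :
    HasDerivAt (momentMean k f) (momentMean (k + 1) f' t) t := by
  have hfc : Continuous f := continuous_iff_continuousAt.2 fun x => (hf x).continuousAt
  obtain ⟨B, hB⟩ := (isCompact_Icc (a := -(|t| + 1)) (b := |t| + 1)).exists_bound_of_continuousOn
    hf'.continuousOn
  have key := intervalIntegral.hasDerivAt_integral_of_dominated_loc_of_deriv_le
    (μ := MeasureTheory.volume) (a := (0 : ℝ)) (b := 1)
    (F := fun t θ => θ ^ k * f (t * θ)) (F' := fun t θ => θ ^ (k + 1) * f' (t * θ))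
    (bound := fun _ => B) (x₀ := t) (Metric.ball_mem_nhds t one_pos)
    (Eventually.of_forall fun x => (by fun_prop : Continuous _).aestronglyMeasurable)
    ((by fun_prop : Continuous _).intervalIntegrable _ _)
    ((by fun_prop : Continuous _).aestronglyMeasurable)
    (Eventually.of_forall fun θ hθ x hx => ?_) (by simp)
    (Eventually.of_forall fun θ hθ x hx => ?_)
  · exact key.2
  · rw [uIoc_of_le zero_le_one] at hθ
    have hx' : |x| ≤ |t| + 1 := by
      have h1 : |x - t| < 1 := by simpa [Real.dist_eq] using hx
      have h2 := abs_add_le (x - t) t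
      rw [sub_add_cancel] at h2
      linarith
    have h1 : |x * θ| ≤ |t| + 1 := by
      rw [abs_mul, abs_of_nonneg hθ.1.le]
      exact (mul_le_of_le_one_right (abs_nonneg x) hθ.2).trans hx'
    have h2 : ‖f' (x * θ)‖ ≤ B := hB _ (abs_le.1 h1)
    have h3 : ‖θ ^ (k + 1)‖ ≤ 1 := by
      rw [Real.norm_eq_abs, abs_of_nonneg (pow_nonneg hθ.1.le _)]
      exact pow_le_one₀ hθ.1.le hθ.2
    rw [norm_mul]
    calc ‖θ ^ (k + 1)‖ * ‖f' (x * θ)‖ ≤ 1 * B := by gcongr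
      _ = B := one_mul B
  · have := ((hf (x * θ)).comp x ((hasDerivAt_id x).mul_const θ)).const_mul (θ ^ k)
    refine this.congr_deriv ?_
    rw [one_mul, pow_succ]; ring

lemma contDiff_momentMean {n : ℕ} {f : ℝ → ℝ} (hf : ContDiff ℝ n f) (k : ℕ) :
    ContDiff ℝ n (momentMean k f) ∧
      iteratedDeriv n (momentMean k f) = momentMean (k + n) (iteratedDeriv n f) := by
  induction n generalizing f k with
  | zero =>
    refine ⟨contDiff_zero.2 (continuous_momentMean hf.continuous), by simp⟩
  | succ n ih =>
    have hf1 := (contDiff_succ_iff_deriv (n := (n : ℕ∞ω))).1 (by exact_mod_cast hf)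
    have hd : deriv (momentMean k f) = momentMean (k + 1) (deriv f) := funext fun t =>
      (hasDerivAt_momentMean (fun x => (hf1.1 x).hasDerivAt) hf1.2.2.continuous t).deriv
    obtain ⟨h1, h2⟩ := ih hf1.2.2 (k + 1)
    constructor
    · have : ContDiff ℝ ((n : ℕ∞ω) + 1) (momentMean k f) := by
        rw [contDiff_succ_iff_deriv]
        refine ⟨fun t => (hasDerivAt_momentMean (fun x => (hf1.1 x).hasDerivAt)
          hf1.2.2.continuous t).differentiableAt, by simp, by rwa [hd]⟩
      exact_mod_cast this
    · rw [iteratedDeriv_succ', hd, h2, iteratedDeriv_succ']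
      congr 1; omega

lemma iteratedDerivWithin_eq_of_eqOn {n : ℕ} {f F : ℝ → ℝ} {s : Set ℝ} (hs : UniqueDiffOn ℝ s)
    (hF : ContDiff ℝ n F) (h : EqOn F f s) :
    EqOn (iteratedDeriv n F) (iteratedDerivWithin n f s) s := fun x hx => by
  rw [← iteratedDerivWithin_congr h hx, iteratedDerivWithin_eq_iteratedDeriv hs hF.contDiffAt hx]

lemma contDiffOn_momentMean {n : ℕ} {T : ℝ} (hT : 0 < T) {f : ℝ → ℝ}
    (hf : ContDiffOn ℝ n f (Icc 0 T)) (k : ℕ) :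
    ContDiffOn ℝ n (momentMean k f) (Icc 0 T) := by
  obtain ⟨F, hF, hFe⟩ := exists_contDiff_eqOn_Icc hT n hf
  exact (contDiff_momentMean hF k).1.contDiffOn.congr fun t ht => momentMean_congr hFe.symm ht

lemma iteratedDerivWithin_momentMean {n : ℕ} {T : ℝ} (hT : 0 < T) {f : ℝ → ℝ}
    (hf : ContDiffOn ℝ n f (Icc 0 T)) (k : ℕ) :
    EqOn (iteratedDerivWithin n (momentMean k f) (Icc 0 T))
      (momentMean (k + n) (iteratedDerivWithin n f (Icc 0 T))) (Icc 0 T) := fun t ht => by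
  obtain ⟨F, hF, hFe⟩ := exists_contDiff_eqOn_Icc hT n hf
  have hu := uniqueDiffOn_Icc hT
  obtain ⟨h1, h2⟩ := contDiff_momentMean hF k
  rw [← iteratedDerivWithin_eq_of_eqOn hu h1 (fun t ht => momentMean_congr hFe ht) ht, h2]
  exact momentMean_congr (iteratedDerivWithin_eq_of_eqOn hu hF hFe) ht

/-! ### The regular singular initial value problem -/

/-- Solutions of the regular singular initial value problem `(t g')' = F (t, g)`, `g 0 = a`, in
integrated form, for bounded `F` that is Lipschitz in `g`. -/
theorem exists_solution_initialValue {F : ℝ → ℝ → ℝ} (hF : Continuous (Function.uncurry F))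
    {M K T : ℝ} (hT : 0 < T) (hK : 0 < K) (hM : ∀ t y, |F t y| ≤ M)
    (hL : ∀ t y z, |F t y - F t z| ≤ K * |y - z|) :
    ∃ g : ℝ → ℝ → ℝ, (∀ a, Continuous (g a)) ∧ (Continuous fun a => g a T) ∧
      ∀ a, ∀ t ∈ Icc 0 T, g a t = a + ∫ s in (0 : ℝ)..t, momentMean 0 (fun σ => F σ (g a σ)) s := by
  have hM0 : 0 ≤ M := (abs_nonneg _).trans (hM 0 0)
  set c : ℝ → ℝ := fun t => max 0 (min t T) with hc
  have hc0 : ∀ t, 0 ≤ c t := fun t => le_max_left _ _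
  have hcT : ∀ t, c t ≤ T := fun t => max_le hT.le (min_le_right _ _)
  have hcc : Continuous c := by fun_prop
  have hcomp : ∀ w : ℝ → ℝ, Continuous w →
      Continuous fun σ => F σ (Real.exp (2 * K * σ) * w σ) := fun w hw =>
    hF.comp (continuous_id.prodMk (by fun_prop : Continuous fun σ => Real.exp (2 * K * σ) * w σ))
  have hmm : ∀ w : ℝ → ℝ, Continuous w →
      Continuous (momentMean 0 fun σ => F σ (Real.exp (2 * K * σ) * w σ)) := fun w hw =>
    continuous_momentMean (hcomp w hw)
  -- in terms of `w t = e^{-2Kt} g t` the integral operator contracts by the factor `1 / 2`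
  let raw : ℝ → (ℝ → ℝ) → ℝ → ℝ := fun a w t => Real.exp (-(2 * K * c t)) *
    (a + ∫ s in (0 : ℝ)..c t, momentMean 0 (fun σ => F σ (Real.exp (2 * K * σ) * w σ)) s)
  have hrawc : ∀ a (w : ℝ → ℝ), Continuous w → Continuous (raw a w) := fun a w hw => by
    have h1 : Continuous fun x => ∫ s in (0 : ℝ)..x,
        momentMean 0 (fun σ => F σ (Real.exp (2 * K * σ) * w σ)) s :=
      intervalIntegral.continuous_primitive (fun _ _ => (hmm w hw).intervalIntegrable _ _) 0
    have h2 := h1.comp hcc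
    exact (by fun_prop : Continuous fun t => Real.exp (-(2 * K * c t))).mul
      (continuous_const.add h2)
  have hexp1 : ∀ t, Real.exp (-(2 * K * c t)) ≤ 1 := fun t => by
    rw [Real.exp_le_one_iff]; have := hc0 t; have : 0 ≤ 2 * K * c t := by positivity
    linarith
  have hrawb : ∀ a (w : ℝ → ℝ) t, ‖raw a w t‖ ≤ |a| + M * T := fun a w t => by
    have h1 : ‖∫ s in (0 : ℝ)..c t,
        momentMean 0 (fun σ => F σ (Real.exp (2 * K * σ) * w σ)) s‖ ≤ M * |c t - 0| :=
      intervalIntegral.norm_integral_le_of_norm_le_const fun s hs => by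
        rw [uIoc_of_le (hc0 t)] at hs
        exact abs_momentMean_le hs.1.le fun σ _ => hM _ _
    rw [sub_zero, abs_of_nonneg (hc0 t)] at h1
    simp only [raw, norm_mul, Real.norm_eq_abs, Real.abs_exp] at h1 ⊢
    have h2 := abs_add_le a (∫ s in (0 : ℝ)..c t,
        momentMean 0 (fun σ => F σ (Real.exp (2 * K * σ) * w σ)) s)
    have h3 : M * c t ≤ M * T := by gcongr; exact hcT t
    calc _ ≤ 1 * (|a| + M * T) := by
          refine mul_le_mul (hexp1 t) (by linarith) (abs_nonneg _) zero_le_one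
      _ = _ := one_mul _
  let Φ : ℝ → (ℝ →ᵇ ℝ) → (ℝ →ᵇ ℝ) := fun a w =>
    BoundedContinuousFunction.ofNormedAddCommGroup (raw a w) (hrawc a w w.continuous) _ (hrawb a w)
  have hΦ : ∀ a w t, Φ a w t = raw a w t := fun a w t => rfl
  have hlip : ∀ a (w z : ℝ →ᵇ ℝ), dist (Φ a w) (Φ a z) ≤ (1 / 2 : ℝ≥0) * dist w z := by
    intro a w z
    refine (BoundedContinuousFunction.dist_le (by positivity)).2 fun t => ?_
    have hmi : ∀ w : ℝ →ᵇ ℝ, IntervalIntegrable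
        (momentMean 0 fun σ => F σ (Real.exp (2 * K * σ) * w σ)) MeasureTheory.volume 0 (c t) :=
      fun w => (hmm w w.continuous).intervalIntegrable _ _
    have hdiff : ∀ s, 0 ≤ s →
        |momentMean 0 (fun σ => F σ (Real.exp (2 * K * σ) * w σ)) s -
          momentMean 0 (fun σ => F σ (Real.exp (2 * K * σ) * z σ)) s| ≤
        K * Real.exp (2 * K * s) * dist w z := by
      intro s hs
      have h1 : momentMean 0 (fun σ => F σ (Real.exp (2 * K * σ) * w σ)) s -
          momentMean 0 (fun σ => F σ (Real.exp (2 * K * σ) * z σ)) s =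
          momentMean 0 (fun σ => F σ (Real.exp (2 * K * σ) * w σ) -
            F σ (Real.exp (2 * K * σ) * z σ)) s := by
        have hw' := hcomp w w.continuous
        have hz' := hcomp z z.continuous
        unfold momentMean
        rw [← intervalIntegral.integral_sub]
        · simp only [pow_zero, one_mul]
        · exact Continuous.intervalIntegrable (by fun_prop) _ _
        · exact Continuous.intervalIntegrable (by fun_prop) _ _
      rw [h1]
      refine abs_momentMean_le hs fun σ hσ => (hL _ _ _).trans ?_
      rw [← mul_sub, abs_mul, Real.abs_exp, mul_assoc K (Real.exp _)]
      have h2 : |w σ - z σ| ≤ dist w z := by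
        rw [← Real.dist_eq]; exact BoundedContinuousFunction.dist_coe_le_dist σ
      have h3 : Real.exp (2 * K * σ) ≤ Real.exp (2 * K * s) := by
        rw [Real.exp_le_exp]; have := hσ.2; gcongr
      gcongr
    rw [Real.dist_eq, hΦ, hΦ]
    simp only [raw]
    rw [← mul_sub, add_sub_add_left_eq_sub, ← intervalIntegral.integral_sub (hmi w) (hmi z),
      abs_mul, Real.abs_exp]
    have h4 : |∫ s in (0 : ℝ)..c t,
        (momentMean 0 (fun σ => F σ (Real.exp (2 * K * σ) * w σ)) s -
          momentMean 0 (fun σ => F σ (Real.exp (2 * K * σ) * z σ)) s)| ≤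
        ∫ s in (0 : ℝ)..c t, K * Real.exp (2 * K * s) * dist w z := by
      rw [← Real.norm_eq_abs]
      refine intervalIntegral.norm_integral_le_of_norm_le (hc0 t) ?_
        ((by fun_prop : Continuous fun s => K * Real.exp (2 * K * s) * dist w z).intervalIntegrable
          _ _)
      exact Eventually.of_forall fun s hs => hdiff s hs.1.le
    have h5 : ∫ s in (0 : ℝ)..c t, K * Real.exp (2 * K * s) * dist w z =
        (Real.exp (2 * K * c t) - 1) / 2 * dist w z := by
      rw [intervalIntegral.integral_mul_const, intervalIntegral.integral_const_mul,
        intervalIntegral.integral_comp_mul_left (fun x => Real.exp x) (by positivity),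
        integral_exp]
      simp only [mul_zero, Real.exp_zero, smul_eq_mul]
      field_simp
    rw [h5] at h4
    calc _ ≤ Real.exp (-(2 * K * c t)) * ((Real.exp (2 * K * c t) - 1) / 2 * dist w z) := by
          gcongr
      _ = (1 - Real.exp (-(2 * K * c t))) / 2 * dist w z := by
          have : Real.exp (-(2 * K * c t)) * Real.exp (2 * K * c t) = 1 := by
            rw [← Real.exp_add]; simp
          linear_combination (dist w z / 2) * this
      _ ≤ 1 / 2 * dist w z := by
          have := Real.exp_pos (-(2 * K * c t))
          gcongr
          linarith
      _ = _ := by norm_num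
  have hcontr : ∀ a, ContractingWith (1 / 2) (Φ a) := fun a =>
    ⟨by rw [← NNReal.coe_lt_coe]; norm_num, LipschitzWith.of_dist_le_mul (hlip a)⟩
  let w : ℝ → (ℝ →ᵇ ℝ) := fun a => (hcontr a).fixedPoint (Φ a)
  have hw : ∀ a, Φ a (w a) = w a := fun a => (hcontr a).fixedPoint_isFixedPt
  have hcont : ∀ a a', dist (w a) (w a') ≤ 2 * dist a a' := by
    intro a a'
    have hz : ∀ z, dist (Φ a z) (Φ a' z) ≤ dist a a' := fun z => by
      refine (BoundedContinuousFunction.dist_le dist_nonneg).2 fun t => ?_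
      rw [Real.dist_eq, hΦ, hΦ]
      simp only [raw]
      rw [← mul_sub, add_sub_add_right_eq_sub, abs_mul, Real.abs_exp, Real.dist_eq]
      exact mul_le_of_le_one_left (abs_nonneg _) (hexp1 t)
    have := (hcontr a).dist_fixedPoint_fixedPoint_of_dist_le' (Φ a') (hw a) (hw a') hz
    refine this.trans (le_of_eq ?_)
    norm_num
    ring
  refine ⟨fun a t => Real.exp (2 * K * t) * w a t, fun a => ?_, ?_, fun a t ht => ?_⟩
  · have := (w a).continuous
    fun_prop
  · refine continuous_const.mul (Metric.continuous_iff.2 fun a δ hδ => ⟨δ / 2, by positivity,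
      fun a' ha' => ?_⟩)
    calc dist (w a' T) (w a T) ≤ dist (w a') (w a) := BoundedContinuousFunction.dist_coe_le_dist T
      _ ≤ 2 * dist a' a := hcont _ _
      _ < δ := by linarith
  · have hct : c t = t := by simp only [hc]; rw [min_eq_left ht.2, max_eq_right ht.1]
    have h1 : w a t = raw a (w a) t := by rw [← hΦ, hw]
    simp only []
    rw [h1]
    simp only [raw, hct]
    rw [← mul_assoc, ← Real.exp_add]
    simp

/-! ### The cut-off source and shooting -/

/-- The nonlinearity `c (e^{2y} - t e^{-2y})` of the equation in the variable `t = r²`. -/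
noncomputable def source (c t y : ℝ) : ℝ := c * (Real.exp (2 * y) - t * Real.exp (-2 * y))

/-- The value `e^{2y}`, cut off to lie between `√t` and `√T`. -/
noncomputable def cutExp (T t y : ℝ) : ℝ :=
  max (Real.exp (2 * min y (1 / 4 * Real.log T))) √(min t T)

/-- A bounded, nonnegative, globally Lipschitz modification of `source`, equal to it where
`√t ≤ e^{2y} ≤ √T`. -/
noncomputable def cutSource (T c t y : ℝ) : ℝ :=
  c * (cutExp T t y - √(min t T) ^ 2 / cutExp T t y)

lemma exp_half_log {T : ℝ} (hT : 0 < T) : Real.exp (2 * (1 / 4 * Real.log T)) = √T := by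
  rw [Real.sqrt_eq_rpow, Real.rpow_def_of_pos hT]; congr 1; ring

lemma cutExp_pos (T t y : ℝ) : 0 < cutExp T t y := lt_max_of_lt_left (Real.exp_pos _)

lemma sqrt_le_cutExp (T t y : ℝ) : √(min t T) ≤ cutExp T t y := le_max_right _ _

lemma cutExp_le {T : ℝ} (hT : 0 < T) (t y : ℝ) : cutExp T t y ≤ √T := by
  refine max_le ?_ (Real.sqrt_le_sqrt (min_le_right _ _))
  rw [← exp_half_log hT, Real.exp_le_exp]
  have := min_le_right y (1 / 4 * Real.log T)
  linarith

lemma abs_exp_sub_exp_le {x y B : ℝ} (hx : Real.exp x ≤ B) (hy : Real.exp y ≤ B) :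
    |Real.exp x - Real.exp y| ≤ B * |x - y| := by
  wlog h : y ≤ x generalizing x y
  · rw [abs_sub_comm, abs_sub_comm x]; exact this hy hx (le_of_not_ge h)
  rw [abs_of_nonneg (sub_nonneg.2 (Real.exp_le_exp.2 h)), abs_of_nonneg (sub_nonneg.2 h)]
  have h1 := Real.add_one_le_exp (y - x)
  have h2 : Real.exp y = Real.exp x * Real.exp (y - x) := by rw [← Real.exp_add]; congr 1; ring
  have h3 : Real.exp x - Real.exp y ≤ Real.exp x * (x - y) := by
    rw [h2]; nlinarith [Real.exp_pos x]
  have : Real.exp x * (x - y) ≤ B * (x - y) := by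
    have := sub_nonneg.2 h; gcongr
  linarith

lemma abs_min_sub_min_le (x y b : ℝ) : |min x b - min y b| ≤ |x - y| := by
  simpa using abs_min_sub_min_le_max x b y b

lemma abs_cutExp_sub_le {T : ℝ} (hT : 0 < T) (t y z : ℝ) :
    |cutExp T t y - cutExp T t z| ≤ 2 * √T * |y - z| := by
  have hle : ∀ y, Real.exp (2 * min y (1 / 4 * Real.log T)) ≤ √T := fun y =>
    (le_max_left _ _).trans (cutExp_le hT t y)
  calc |cutExp T t y - cutExp T t z|
      ≤ |Real.exp (2 * min y (1 / 4 * Real.log T)) -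
          Real.exp (2 * min z (1 / 4 * Real.log T))| := by
        unfold cutExp
        exact abs_max_sub_max_le_abs _ _ _
    _ ≤ √T * |2 * min y (1 / 4 * Real.log T) - 2 * min z (1 / 4 * Real.log T)| :=
        abs_exp_sub_exp_le (hle y) (hle z)
    _ = 2 * √T * |min y (1 / 4 * Real.log T) - min z (1 / 4 * Real.log T)| := by
        rw [← mul_sub, abs_mul]; norm_num; ring
    _ ≤ _ := mul_le_mul_of_nonneg_left (abs_min_sub_min_le _ _ _) (by positivity)

lemma cutSource_nonneg {T c : ℝ} (hc : 0 < c) (t y : ℝ) : 0 ≤ cutSource T c t y := by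
  refine mul_nonneg hc.le (sub_nonneg.2 ((div_le_iff₀ (cutExp_pos T t y)).2 ?_))
  have := sqrt_le_cutExp T t y
  nlinarith [Real.sqrt_nonneg (min t T)]

lemma cutSource_le {T c : ℝ} (hT : 0 < T) (hc : 0 < c) (t y : ℝ) :
    cutSource T c t y ≤ c * √T := by
  refine mul_le_mul_of_nonneg_left ?_ hc.le
  have h1 := cutExp_le hT t y
  have h2 : 0 ≤ √(min t T) ^ 2 / cutExp T t y := div_nonneg (sq_nonneg _) (cutExp_pos T t y).le
  linarith

lemma abs_cutSource_sub_le {T c : ℝ} (hT : 0 < T) (hc : 0 < c) (t y z : ℝ) :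
    |cutSource T c t y - cutSource T c t z| ≤ 4 * c * √T * |y - z| := by
  have key : ∀ τ p q : ℝ, 0 ≤ τ → τ ≤ p → τ ≤ q → 0 < p → 0 < q →
      |(p - τ ^ 2 / p) - (q - τ ^ 2 / q)| ≤ 2 * |p - q| := by
    intro τ p q hτ hp hq hp0 hq0
    have h1 : (p - τ ^ 2 / p) - (q - τ ^ 2 / q) = (1 + τ ^ 2 / (p * q)) * (p - q) := by
      field_simp; ring
    have h2 : τ ^ 2 / (p * q) ≤ 1 := by
      rw [div_le_one (by positivity), sq]; gcongr
    have h3 : 0 ≤ τ ^ 2 / (p * q) := by positivity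
    rw [h1, abs_mul, abs_of_nonneg (by linarith)]
    gcongr; linarith
  unfold cutSource
  rw [← mul_sub, abs_mul, abs_of_pos hc]
  have h1 := key _ _ _ (Real.sqrt_nonneg (min t T)) (sqrt_le_cutExp T t y) (sqrt_le_cutExp T t z)
    (cutExp_pos T t y) (cutExp_pos T t z)
  have h2 := abs_cutExp_sub_le hT t y z
  calc _ ≤ c * (2 * (2 * √T * |y - z|)) := by gcongr; linarith
    _ = _ := by ring

lemma continuous_cutSource (T c : ℝ) : Continuous (Function.uncurry (cutSource T c)) := by
  have h : Continuous fun p : ℝ × ℝ => cutExp T p.1 p.2 := by unfold cutExp; fun_prop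
  have h' : ∀ p : ℝ × ℝ, cutExp T p.1 p.2 ≠ 0 := fun p => (cutExp_pos _ _ _).ne'
  have : Continuous fun p : ℝ × ℝ => √(min p.1 T) ^ 2 := by fun_prop
  exact continuous_const.mul (h.sub (this.div h h'))

lemma cutSource_eq_source {T c t y : ℝ} (ht : t ∈ Icc 0 T)
    (hy : y ≤ 1 / 4 * Real.log T) (hty : √t ≤ Real.exp (2 * y)) :
    cutSource T c t y = source c t y := by
  have h : cutExp T t y = Real.exp (2 * y) := by
    rw [cutExp, min_eq_left hy, min_eq_left ht.2, max_eq_left hty]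
  rw [cutSource, source, h, min_eq_left ht.2, Real.sq_sqrt ht.1, div_eq_mul_inv, ← Real.exp_neg]
  congr 4; ring

lemma cutSource_eq_zero {T c t y : ℝ} (ht : t ∈ Icc 0 T)
    (hy : y ≤ 1 / 4 * Real.log T) (hty : Real.exp (2 * y) ≤ √t) :
    cutSource T c t y = 0 := by
  have h : cutExp T t y = √t := by
    rw [cutExp, min_eq_left hy, min_eq_left ht.2, max_eq_right hty]
  rw [cutSource, h, min_eq_left ht.2, sq, mul_self_div_self, sub_self, mul_zero]

lemma mul_momentMean_zero (f : ℝ → ℝ) (t : ℝ) :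
    t * momentMean 0 f t = ∫ s in (0 : ℝ)..t, f s := by
  simp [momentMean]

lemma momentMean_nonneg {k : ℕ} {f : ℝ → ℝ} {t : ℝ} (ht : 0 ≤ t) (hf : ∀ s ∈ Icc 0 t, 0 ≤ f s) :
    0 ≤ momentMean k f t := by
  refine intervalIntegral.integral_nonneg zero_le_one fun θ hθ => mul_nonneg (pow_nonneg hθ.1 k)
    (hf _ ⟨mul_nonneg ht hθ.1, mul_le_of_le_one_right ht hθ.2⟩)

/-- Solution of the cut-off boundary value problem, by shooting from the origin. -/
theorem exists_cut_solution {T c : ℝ} (hT : 0 < T) (hc : 0 < c) :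
    ∃ g : ℝ → ℝ, Continuous g ∧ g T = 1 / 4 * Real.log T ∧
      ∀ t ∈ Icc 0 T,
        g t = g 0 + ∫ s in (0 : ℝ)..t, momentMean 0 (fun σ => cutSource T c σ (g σ)) s := by
  have hsT : 0 < √T := Real.sqrt_pos.2 hT
  have habs : ∀ t y, |cutSource T c t y| ≤ c * √T := fun t y => by
    rw [abs_of_nonneg (cutSource_nonneg hc t y)]; exact cutSource_le hT hc t y
  obtain ⟨g, hg, hgT, hge⟩ := exists_solution_initialValue (continuous_cutSource T c) hT
    (by positivity : 0 < 4 * c * √T) habs (abs_cutSource_sub_le hT hc)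
  set b := 1 / 4 * Real.log T
  have hb : ∀ a, |g a T - a| ≤ c * √T * T := fun a => by
    rw [hge a T ⟨hT.le, le_rfl⟩, add_sub_cancel_left]
    have := intervalIntegral.norm_integral_le_of_norm_le_const (a := 0) (b := T) (C := c * √T)
      (f := momentMean 0 (fun σ => cutSource T c σ (g a σ))) fun s hs => by
        rw [uIoc_of_le hT.le] at hs
        exact abs_momentMean_le hs.1.le fun σ _ => habs _ _
    rwa [sub_zero, abs_of_pos hT] at this
  have h1 := abs_le.1 (hb (b - c * √T * T))
  have h2 := abs_le.1 (hb (b + c * √T * T))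
  have hle : b - c * √T * T ≤ b + c * √T * T := by
    have : 0 ≤ c * √T * T := by positivity
    linarith
  obtain ⟨a, -, ha⟩ := intermediate_value_Icc hle hgT.continuousOn (show b ∈ _ from
    ⟨by linarith [h1.2], by linarith [h2.1]⟩)
  refine ⟨g a, hg a, ha, fun t ht => ?_⟩
  have h0 : g a 0 = a := by rw [hge a 0 ⟨le_rfl, hT.le⟩]; simp
  rw [h0]; exact hge a t ht

/-! ### Existence and smoothness of the profile -/

/-- `g` is the profile of a radial solution in the variable `t = r²`: a smooth solution of
`(t g')' = c (e^{2g} - t e^{-2g})` on `[0, T]`, in the form `g' = (1/t) ∫₀ᵗ`, which takes the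
boundary value of `(1/4) log t` at `T` and lies above `(1/4) log t`. -/
structure IsProfile (T c : ℝ) (g : ℝ → ℝ) : Prop where
  contDiffOn : ContDiffOn ℝ ∞ g (Icc 0 T)
  hasDerivWithinAt : ∀ t ∈ Icc 0 T,
    HasDerivWithinAt g (momentMean 0 (fun s => source c s (g s)) t) (Icc 0 T) t
  boundary : g T = 1 / 4 * Real.log T
  sqrt_le : ∀ t ∈ Icc 0 T, √t ≤ Real.exp (2 * g t)

lemma contDiffOn_source {n : ℕ∞ω} {c : ℝ} {g : ℝ → ℝ} {s : Set ℝ} (hg : ContDiffOn ℝ n g s) :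
    ContDiffOn ℝ n (fun t => source c t (g t)) s := by
  unfold source
  exact contDiffOn_const.mul (((contDiffOn_const.mul hg).exp).sub
    (contDiffOn_id.mul ((contDiffOn_const.mul hg).exp)))

/-- Bootstrapping: if `g` is `Cⁿ`, so is the mean that equals `g'`. -/
lemma contDiffOn_of_hasDerivWithinAt_momentMean {T c : ℝ} (hT : 0 < T) {g : ℝ → ℝ}
    (hg : ∀ t ∈ Icc 0 T,
      HasDerivWithinAt g (momentMean 0 (fun s => source c s (g s)) t) (Icc 0 T) t) :
    ContDiffOn ℝ ∞ g (Icc 0 T) := by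
  refine contDiffOn_infty.2 fun n => ?_
  induction n with
  | zero => exact contDiffOn_zero.2 fun t ht => (hg t ht).continuousWithinAt
  | succ n ih =>
    have h : ContDiffOn ℝ ((n : ℕ∞ω) + 1) g (Icc 0 T) := by
      rw [contDiffOn_succ_iff_derivWithin (uniqueDiffOn_Icc hT)]
      refine ⟨fun t ht => (hg t ht).differentiableWithinAt, by simp, ?_⟩
      exact (contDiffOn_momentMean hT (contDiffOn_source ih) 0).congr fun t ht =>
        (hg t ht).derivWithin (uniqueDiffOn_Icc hT t ht)
    exact_mod_cast h

lemma sqrt_le_exp_iff {t y : ℝ} (ht : 0 < t) :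
    √t ≤ Real.exp (2 * y) ↔ 1 / 4 * Real.log t ≤ y := by
  rw [← exp_half_log ht, Real.exp_le_exp]
  constructor <;> intro h <;> linarith

/-- A solution of the cut-off problem solves the original problem. It increases because the
cut-off source is nonnegative, so it stays below its boundary value. If `g - (1/4) log t` had a
negative minimum, `t g'` would be constant near the minimum, hence so would be
`g - (1/4) log t`; at the largest minimum point this is absurd. -/
theorem isProfile_of_cut_solution {T c : ℝ} (hT : 0 < T) (hc : 0 < c) {g : ℝ → ℝ}
    (hg : Continuous g) (hgT : g T = 1 / 4 * Real.log T)
    (hge : ∀ t ∈ Icc 0 T,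
      g t = g 0 + ∫ s in (0 : ℝ)..t, momentMean 0 (fun σ => cutSource T c σ (g σ)) s) :
    IsProfile T c g := by
  set f : ℝ → ℝ := fun σ => cutSource T c σ (g σ) with hf
  have hfc : Continuous f := (continuous_cutSource T c).comp (continuous_id.prodMk hg)
  have hf0 : ∀ t, 0 ≤ f t := fun t => cutSource_nonneg hc _ _
  have hHc : Continuous (momentMean 0 f) := continuous_momentMean hfc
  have hder : ∀ t ∈ Icc 0 T, HasDerivWithinAt g (momentMean 0 f t) (Icc 0 T) t := fun t ht =>
    (((hHc.integral_hasStrictDerivAt 0 t).hasDerivAt.const_add (g 0)).hasDerivWithinAt).congr hge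
      (hge t ht)
  have hmono : MonotoneOn g (Icc 0 T) := by
    refine monotoneOn_of_hasDerivWithinAt_nonneg (convex_Icc 0 T) hg.continuousOn
      (f' := momentMean 0 f) (fun t ht => (hder t (interior_subset ht)).mono interior_subset)
      fun t ht => momentMean_nonneg (interior_subset ht).1 fun s _ => hf0 s
  have hle : ∀ t ∈ Icc 0 T, g t ≤ 1 / 4 * Real.log T := fun t ht => by
    rw [← hgT]; exact hmono ht ⟨hT.le, le_rfl⟩ ht.2
  have hsqrt : ∀ t ∈ Icc 0 T, √t ≤ Real.exp (2 * g t) := by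
    by_contra! hcon
    obtain ⟨t₁, ht₁, hlt⟩ := hcon
    have ht₁0 : 0 < t₁ := by
      rcases ht₁.1.eq_or_lt with h | h
      · rw [← h, Real.sqrt_zero] at hlt
        exact absurd hlt (Real.exp_pos _).le.not_gt
      · exact h
    let V : ℝ → ℝ := fun t => g t - 1 / 4 * Real.log t
    have hV₁ : V t₁ < 0 := by
      have := (sqrt_le_exp_iff (y := g t₁) ht₁0).not.1 hlt.not_ge
      simp only [V]; linarith
    -- for `t ≤ t₀` one has `(1/4) log t ≤ g 0 ≤ g t`
    set t₀ := Real.exp (4 * g 0)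
    have ht₀ : 0 < t₀ := Real.exp_pos _
    have hVt₀ : ∀ t, 0 < t → t ≤ t₀ → t ≤ T → 0 ≤ V t := fun t h0 h1 h2 => by
      have h3 := hmono ⟨le_rfl, hT.le⟩ ⟨h0.le, h2⟩ h0.le
      have h4 : Real.log t ≤ 4 * g 0 := by
        rw [← Real.log_exp (4 * g 0)]; exact Real.log_le_log h0 h1
      simp only [V]; linarith
    have ht₀₁ : t₀ < t₁ := by
      by_contra! h
      exact absurd (hVt₀ t₁ ht₁0 h ht₁.2) (not_le.2 hV₁)
    have hVc : ContinuousOn V (Icc t₀ T) :=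
      hg.continuousOn.sub (continuousOn_const.mul
        (Real.continuousOn_log.mono fun t ht => (ht₀.trans_le ht.1).ne'))
    obtain ⟨t₂, ht₂, hmin⟩ := isCompact_Icc.exists_isMinOn
      (⟨t₁, ht₀₁.le, ht₁.2⟩ : (Icc t₀ T).Nonempty) hVc
    have hV₂ : V t₂ < 0 := (hmin ⟨ht₀₁.le, ht₁.2⟩).trans_lt hV₁
    -- `t` is the largest minimum point of `V`
    have hcpt : IsCompact (Icc t₀ T ∩ V ⁻¹' {V t₂}) :=
      isCompact_Icc.of_isClosed_subset (hVc.preimage_isClosed_of_isClosed isClosed_Icc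
        isClosed_singleton) inter_subset_left
    obtain ⟨t, ⟨ht, hVt⟩, hgr⟩ := hcpt.exists_isGreatest ⟨t₂, ht₂, rfl⟩
    have hVt : V t = V t₂ := hVt
    have hVneg : V t < 0 := hVt ▸ hV₂
    have htT : t < T := by
      rcases ht.2.eq_or_lt with h | h
      · rw [h] at hVneg; simp only [V, hgT, sub_self, lt_irrefl] at hVneg
      · exact h
    have ht0 : t₀ < t := by
      by_contra! h
      exact absurd (hVt₀ t (ht₀.trans_le ht.1) h ht.2) (not_le.2 hVneg)
    have hnhds : ∀ᶠ s in 𝓝 t, s ∈ Ioo t₀ T := Ioo_mem_nhds ht0 htT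
    have hVder : ∀ s ∈ Ioo t₀ T, HasDerivAt V (momentMean 0 f s - 1 / 4 * s⁻¹) s := fun s hs => by
      have hs' : s ∈ Icc 0 T := ⟨(ht₀.trans hs.1).le, hs.2.le⟩
      exact ((hder s hs').hasDerivAt (Icc_mem_nhds (ht₀.trans hs.1) hs.2)).sub
        ((Real.hasDerivAt_log (ht₀.trans hs.1).ne').const_mul _)
    have hlmin : IsLocalMin V t := by
      filter_upwards [hnhds] with s hs
      rw [hVt]; exact hmin ⟨hs.1.le, hs.2.le⟩
    have htpos : 0 < t := ht₀.trans ht0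
    have h14 : ∫ s in (0 : ℝ)..t, f s = 1 / 4 := by
      have := hlmin.hasDerivAt_eq_zero (hVder t ⟨ht0, htT⟩)
      rw [← mul_momentMean_zero, sub_eq_zero.1 this]
      field_simp
    have hVev : ∀ᶠ s in 𝓝 t, V s < 0 :=
      (hVder t ⟨ht0, htT⟩).continuousAt.eventually_lt_const hVneg
    obtain ⟨δ, hδ, hball⟩ := Metric.eventually_nhds_iff_ball.1 (hnhds.and hVev)
    have hseg : ∀ s ∈ Icc t (t + δ / 2), s ∈ Ioo t₀ T ∧ V s < 0 := fun s hs => by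
      refine hball s ?_
      rw [Metric.mem_ball, Real.dist_eq, abs_of_nonneg (by linarith [hs.1])]
      linarith [hs.2]
    have hfz : ∀ s ∈ Icc t (t + δ / 2), f s = 0 := fun s hs => by
      obtain ⟨h1, h2⟩ := hseg s hs
      have hs' : s ∈ Icc 0 T := ⟨(ht₀.trans h1.1).le, h1.2.le⟩
      refine cutSource_eq_zero hs' (hle s hs') (le_of_not_ge fun h => ?_)
      have := (sqrt_le_exp_iff (y := g s) (ht₀.trans h1.1)).1 h
      simp only [V] at h2; linarith
    have hVd0 : ∀ s ∈ Icc t (t + δ / 2), HasDerivAt V 0 s := fun s hs => by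
      have h1 := (hseg s hs).1
      have hs0 : 0 < s := ht₀.trans h1.1
      have h2 : ∫ x in (0 : ℝ)..s, f x = 1 / 4 := by
        rw [← intervalIntegral.integral_add_adjacent_intervals (hfc.intervalIntegrable 0 t)
          (hfc.intervalIntegrable t s), h14, intervalIntegral.integral_congr (g := fun _ => 0)]
        · simp
        · intro x hx
          rw [uIcc_of_le hs.1] at hx
          exact hfz x ⟨hx.1, hx.2.trans hs.2⟩
      refine (hVder s h1).congr_deriv ?_
      rw [← mul_momentMean_zero] at h2
      rw [← h2]; field_simp; ring
    have hconst := constant_of_has_deriv_right_zero (f := V) (a := t) (b := t + δ / 2)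
      (fun s hs => (hVd0 s hs).continuousAt.continuousWithinAt)
      (fun s hs => (hVd0 s ⟨hs.1, hs.2.le⟩).hasDerivWithinAt) (t + δ / 2)
      ⟨by linarith, le_rfl⟩
    have h1 := hseg (t + δ / 2) ⟨by linarith, le_rfl⟩
    have : t + δ / 2 ≤ t := hgr ⟨⟨h1.1.1.le, h1.1.2.le⟩, hconst.trans hVt⟩
    linarith
  have hfs : EqOn f (fun s => source c s (g s)) (Icc 0 T) := fun t ht =>
    cutSource_eq_source ht (hle t ht) (hsqrt t ht)
  have hder' : ∀ t ∈ Icc 0 T,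
      HasDerivWithinAt g (momentMean 0 (fun s => source c s (g s)) t) (Icc 0 T) t :=
    fun t ht => (hder t ht).congr_deriv (momentMean_congr hfs ht)
  exact ⟨contDiffOn_of_hasDerivWithinAt_momentMean hT hder', hder', hgT, hsqrt⟩

theorem exists_isProfile {T c : ℝ} (hT : 0 < T) (hc : 0 < c) : ∃ g, IsProfile T c g := by
  obtain ⟨g, hg, hgT, hge⟩ := exists_cut_solution hT hc
  exact ⟨g, isProfile_of_cut_solution hT hc hg hgT hge⟩

/-! ### The differentiated equation -/

/-- Integration by parts in `∫₀¹ θᵏ⁺¹ t f' (t θ) dθ`. -/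
lemma mul_momentMean_succ {T t : ℝ} (hT : 0 < T) {f : ℝ → ℝ} (hf : ContDiffOn ℝ 1 f (Icc 0 T))
    (k : ℕ) (ht : t ∈ Icc 0 T) :
    t * momentMean (k + 1) (derivWithin f (Icc 0 T)) t + (k + 1) * momentMean k f t = f t := by
  obtain ⟨F, hF, hFe⟩ := exists_contDiff_eqOn_Icc hT 1 (by exact_mod_cast hf)
  have hF1 : ContDiff ℝ 1 F := by exact_mod_cast hF
  have hd : EqOn (derivWithin f (Icc 0 T)) (deriv F) (Icc 0 T) := fun s hs => by
    rw [← derivWithin_congr hFe (hFe hs)]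
    exact ((hF1.differentiable one_ne_zero) s).derivWithin (uniqueDiffOn_Icc hT s hs)
  rw [momentMean_congr hd ht, momentMean_congr hFe.symm ht, ← hFe ht]
  have hdc : Continuous (deriv F) := hF1.continuous_deriv le_rfl
  have hFc := hF1.continuous
  have hder : ∀ θ ∈ uIcc (0 : ℝ) 1, HasDerivAt (fun θ => θ ^ (k + 1) * F (t * θ))
      (t * (θ ^ (k + 1) * deriv F (t * θ)) + (k + 1) * (θ ^ k * F (t * θ))) θ := fun θ _ => by
    have h1 := ((hF1.differentiable one_ne_zero) (t * θ)).hasDerivAt.comp θ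
      ((hasDerivAt_id θ).const_mul t)
    refine ((hasDerivAt_pow (k + 1) θ).mul h1).congr_deriv ?_
    simp; ring
  have hint := intervalIntegral.integral_eq_sub_of_hasDerivAt hder
    ((by fun_prop : Continuous fun θ => t * (θ ^ (k + 1) * deriv F (t * θ)) +
      (k + 1) * (θ ^ k * F (t * θ))).intervalIntegrable _ _)
  rw [intervalIntegral.integral_add
    ((by fun_prop : Continuous fun θ => t * (θ ^ (k + 1) * deriv F (t * θ))).intervalIntegrable _ _)
    ((by fun_prop : Continuous fun θ => (k + 1) * (θ ^ k * F (t * θ))).intervalIntegrable _ _),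
    intervalIntegral.integral_const_mul, intervalIntegral.integral_const_mul] at hint
  simpa [momentMean] using hint

namespace IsProfile

variable {T c : ℝ} {g : ℝ → ℝ}

lemma derivWithin_eq (h : IsProfile T c g) (hT : 0 < T) :
    EqOn (derivWithin g (Icc 0 T)) (momentMean 0 fun s => source c s (g s)) (Icc 0 T) :=
  fun t ht => (h.hasDerivWithinAt t ht).derivWithin (uniqueDiffOn_Icc hT t ht)

lemma contDiffOn_source (h : IsProfile T c g) :
    ContDiffOn ℝ ∞ (fun s => source c s (g s)) (Icc 0 T) :=
  _root_.contDiffOn_source h.contDiffOn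

lemma iteratedDerivWithin_succ (h : IsProfile T c g) (hT : 0 < T) (n : ℕ) :
    EqOn (iteratedDerivWithin (n + 1) g (Icc 0 T))
      (momentMean n (iteratedDerivWithin n (fun s => source c s (g s)) (Icc 0 T)))
      (Icc 0 T) := fun t ht => by
  rw [iteratedDerivWithin_succ', iteratedDerivWithin_congr (h.derivWithin_eq hT) ht,
    iteratedDerivWithin_momentMean hT
      (h.contDiffOn_source.of_le (by exact_mod_cast le_top)) 0 ht, zero_add]

/-- The differential equation, differentiated `n` times. -/
lemma mul_iteratedDerivWithin (h : IsProfile T c g) (hT : 0 < T) (n : ℕ) {t : ℝ}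
    (ht : t ∈ Icc 0 T) :
    t * iteratedDerivWithin (n + 2) g (Icc 0 T) t +
      (n + 1) * iteratedDerivWithin (n + 1) g (Icc 0 T) t =
      iteratedDerivWithin n (fun s => source c s (g s)) (Icc 0 T) t := by
  have hu := uniqueDiffOn_Icc hT
  have hf : ContDiffOn ℝ 1 (iteratedDerivWithin n (fun s => source c s (g s)) (Icc 0 T))
      (Icc 0 T) := by
    have := (contDiffOn_nat_succ_iff_contDiffOn_one_iteratedDerivWithin (n := n) hu).1
      (h.contDiffOn_source.of_le (by exact_mod_cast le_top))
    exact this.2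
  rw [h.iteratedDerivWithin_succ hT (n + 1) ht, h.iteratedDerivWithin_succ hT n ht]
  rw [← mul_momentMean_succ hT hf n ht]
  congr 3
  rw [_root_.iteratedDerivWithin_succ]

end IsProfile

/-! ### Pointwise bounds for the profile -/

lemma hasDerivWithinAt_iteratedDerivWithin {f : ℝ → ℝ} {s : Set ℝ} (hs : UniqueDiffOn ℝ s)
    (hf : ContDiffOn ℝ ∞ f s) (n : ℕ) {x : ℝ} (hx : x ∈ s) :
    HasDerivWithinAt (iteratedDerivWithin n f s) (iteratedDerivWithin (n + 1) f s x) s x := by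
  have h := hf.differentiableOn_iteratedDerivWithin (m := n)
    (by exact_mod_cast ENat.natCast_lt_top n) hs x hx
  rw [iteratedDerivWithin_succ]
  exact h.hasDerivWithinAt

/-- The factor `π² ε⁻²` in front of the nonlinearity, in the variable `t = r²`. -/
noncomputable def coef (ε : ℝ) : ℝ := Real.pi ^ 2 * (ε ^ 2)⁻¹

lemma coef_pos {ε : ℝ} (hε : 0 < ε) : 0 < coef ε := by
  have := Real.pi_pos; unfold coef; positivity

namespace IsProfile

variable {T c : ℝ} {g : ℝ → ℝ}

lemma mul_exp_neg_le (h : IsProfile T c g) {t : ℝ} (ht : t ∈ Icc 0 T) :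
    t * Real.exp (-2 * g t) ≤ √t := by
  have h1 := h.sqrt_le t ht
  rw [show -2 * g t = -(2 * g t) by ring, Real.exp_neg, ← div_eq_mul_inv,
    div_le_iff₀ (Real.exp_pos _)]
  calc t = √t * √t := (Real.mul_self_sqrt ht.1).symm
    _ ≤ _ := by gcongr

lemma source_nonneg (h : IsProfile T c g) (hc : 0 < c) {t : ℝ} (ht : t ∈ Icc 0 T) :
    0 ≤ source c t (g t) :=
  mul_nonneg hc.le (sub_nonneg.2 ((h.mul_exp_neg_le ht).trans (h.sqrt_le t ht)))

lemma momentMean_source_nonneg (h : IsProfile T c g) (hc : 0 < c) {t : ℝ} (ht : t ∈ Icc 0 T) :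
    0 ≤ momentMean 0 (fun s => source c s (g s)) t :=
  momentMean_nonneg ht.1 fun _ hs => h.source_nonneg hc ⟨hs.1, hs.2.trans ht.2⟩

lemma monotoneOn (h : IsProfile T c g) (hc : 0 < c) : MonotoneOn g (Icc 0 T) :=
  monotoneOn_of_hasDerivWithinAt_nonneg (convex_Icc 0 T) h.contDiffOn.continuousOn
    (fun t ht => (h.hasDerivWithinAt t (interior_subset ht)).mono interior_subset)
    fun _ ht => h.momentMean_source_nonneg hc (interior_subset ht)

lemma exp_le (h : IsProfile T c g) (hT : 0 < T) (hc : 0 < c) {t : ℝ} (ht : t ∈ Icc 0 T) :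
    Real.exp (2 * g t) ≤ √T := by
  rw [← exp_half_log hT, Real.exp_le_exp, ← h.boundary]
  have := h.monotoneOn hc ht ⟨hT.le, le_rfl⟩ ht.2
  linarith

lemma abs_source_le (h : IsProfile T c g) (hT : 0 < T) (hc : 0 < c) {t : ℝ} (ht : t ∈ Icc 0 T) :
    |source c t (g t)| ≤ c * √T := by
  rw [abs_of_nonneg (h.source_nonneg hc ht)]
  refine mul_le_mul_of_nonneg_left ?_ hc.le
  have h1 := h.exp_le hT hc ht
  have h2 := mul_nonneg ht.1 (Real.exp_pos (-2 * g t)).le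
  linarith

lemma abs_momentMean_source_le (h : IsProfile T c g) (hT : 0 < T) (hc : 0 < c) {t : ℝ}
    (ht : t ∈ Icc 0 T) :
    |momentMean 0 (fun s => source c s (g s)) t| ≤ c * √T :=
  abs_momentMean_le ht.1 fun _ hs => h.abs_source_le hT hc ⟨hs.1, hs.2.trans ht.2⟩

/-- The energy `t g'² - c e^{2g}` is nonincreasing and negative at `0`. In the radial variable
this says `|u'| ≤ 2 √c e^u`. -/
lemma mul_deriv_sq_le (h : IsProfile T c g) (hT : 0 < T) (hc : 0 < c) {t : ℝ}
    (ht : t ∈ Icc 0 T) :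
    t * iteratedDerivWithin 1 g (Icc 0 T) t ^ 2 ≤ c * √T := by
  have hu := uniqueDiffOn_Icc hT
  set g1 := iteratedDerivWithin 1 g (Icc 0 T)
  set g2 := iteratedDerivWithin 2 g (Icc 0 T)
  have hg1 : ∀ s ∈ Icc 0 T, HasDerivWithinAt g (g1 s) (Icc 0 T) s := fun s hs => by
    have := hasDerivWithinAt_iteratedDerivWithin hu h.contDiffOn 0 hs
    rwa [iteratedDerivWithin_zero] at this
  have hg2 : ∀ s ∈ Icc 0 T, HasDerivWithinAt g1 (g2 s) (Icc 0 T) s := fun s hs =>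
    hasDerivWithinAt_iteratedDerivWithin hu h.contDiffOn 1 hs
  have hder : ∀ s ∈ Icc 0 T, HasDerivWithinAt (fun s => s * g1 s ^ 2 - c * Real.exp (2 * g s))
      (1 * g1 s ^ 2 + s * (2 * g1 s * g2 s) - c * (Real.exp (2 * g s) * (2 * g1 s)))
      (Icc 0 T) s := fun s hs => by
    have h1 := ((hasDerivWithinAt_id s (Icc 0 T)).mul ((hg2 s hs).pow 2)).sub
      ((((hg1 s hs).const_mul 2).exp).const_mul c)
    refine h1.congr_deriv ?_
    simp
  have hanti : AntitoneOn (fun s => s * g1 s ^ 2 - c * Real.exp (2 * g s)) (Icc 0 T) := by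
    refine antitoneOn_of_hasDerivWithinAt_nonpos (convex_Icc 0 T)
      (fun s hs => (hder s hs).continuousWithinAt)
      (fun s hs => (hder s (interior_subset hs)).mono interior_subset) fun s hs => ?_
    have hs := interior_subset hs
    have hode := h.mul_iteratedDerivWithin hT 0 hs
    simp only [zero_add, Nat.cast_zero, one_mul, iteratedDerivWithin_zero] at hode
    change s * g2 s + g1 s = _ at hode
    have hpos : 0 ≤ g1 s := by
      have := h.momentMean_source_nonneg hc hs
      rwa [← (h.hasDerivWithinAt s hs).derivWithin (hu s hs), ← iteratedDerivWithin_one] at this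
    have h3 : 1 * g1 s ^ 2 + s * (2 * g1 s * g2 s) - c * (Real.exp (2 * g s) * (2 * g1 s)) =
        -(g1 s ^ 2) - 2 * c * (s * Real.exp (-2 * g s)) * g1 s := by
      have : s * g2 s = c * (Real.exp (2 * g s) - s * Real.exp (-2 * g s)) - g1 s := by
        rw [← source]; linarith
      linear_combination 2 * g1 s * this
    rw [h3]
    have h4 : 0 ≤ 2 * c * (s * Real.exp (-2 * g s)) * g1 s :=
      mul_nonneg (mul_nonneg (by positivity) (mul_nonneg hs.1 (Real.exp_pos _).le)) hpos
    linarith [sq_nonneg (g1 s)]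
  have h5 := hanti ⟨le_rfl, hT.le⟩ ht ht.1
  have h6 := mul_le_mul_of_nonneg_left (h.exp_le hT hc ht) hc.le
  have h7 := mul_pos hc (Real.exp_pos (2 * g 0))
  simp only [zero_mul] at h5
  linarith

end IsProfile

/-- A constant with `e^{-2u} ≤ A / ε` for every profile. -/
noncomputable def expNegConst (T : ℝ) : ℝ := 1 + Real.exp (2 * (Real.pi ^ 2 * T * √T)) / √T

lemma one_le_expNegConst (T : ℝ) : 1 ≤ expNegConst T := by
  have : 0 ≤ Real.exp (2 * (Real.pi ^ 2 * T * √T)) / √T := by positivity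
  unfold expNegConst; linarith

namespace IsProfile

variable {T ε : ℝ} {g : ℝ → ℝ}

/-- As `g' = O(ε⁻²)`, going down from `t = ε² T`, where `g ≥ (1/4) log t`, to `t = 0` costs only a
bounded amount. -/
lemma exp_neg_le_div (h : IsProfile T (coef ε) g) (hT : 0 < T) (hε : 0 < ε) (hε1 : ε ≤ 1) {t : ℝ}
    (ht : t ∈ Icc 0 T) : Real.exp (-2 * g t) ≤ expNegConst T / ε := by
  have hc := coef_pos hε
  have hδ : ε ^ 2 * T ∈ Icc 0 T :=
    ⟨by positivity, mul_le_of_le_one_left hT.le (pow_le_one₀ hε.le hε1)⟩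
  have h1 : g (ε ^ 2 * T) - g 0 ≤ Real.pi ^ 2 * T * √T := by
    have := (convex_Icc 0 T).norm_image_sub_le_of_norm_hasDerivWithin_le h.hasDerivWithinAt
      (fun s hs => h.abs_momentMean_source_le hT hc hs) ⟨le_rfl, hT.le⟩ hδ
    refine (le_abs_self _).trans (this.trans (le_of_eq ?_))
    rw [sub_zero, Real.norm_eq_abs, abs_of_nonneg hδ.1, coef]
    field_simp
  have h2 := h.sqrt_le _ hδ
  rw [Real.sqrt_mul (by positivity), Real.sqrt_sq hε.le] at h2
  have h3 := h.monotoneOn hc ⟨le_rfl, hT.le⟩ ht ht.1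
  have hsT := Real.sqrt_pos.2 hT
  have h4 : Real.exp (-2 * g (ε ^ 2 * T)) ≤ 1 / (ε * √T) := by
    rw [show -2 * g (ε ^ 2 * T) = -(2 * g (ε ^ 2 * T)) by ring, Real.exp_neg, ← one_div]
    gcongr
  calc Real.exp (-2 * g t)
      ≤ Real.exp (2 * (Real.pi ^ 2 * T * √T) + -2 * g (ε ^ 2 * T)) := by
        rw [Real.exp_le_exp]; linarith
    _ = Real.exp (2 * (Real.pi ^ 2 * T * √T)) * Real.exp (-2 * g (ε ^ 2 * T)) := Real.exp_add _ _
    _ ≤ Real.exp (2 * (Real.pi ^ 2 * T * √T)) * (1 / (ε * √T)) := by gcongr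
    _ = Real.exp (2 * (Real.pi ^ 2 * T * √T)) / √T / ε := by field_simp
    _ ≤ _ := by unfold expNegConst; gcongr; linarith

lemma exp_neg_le_div_max (h : IsProfile T (coef ε) g) (hT : 0 < T) (hε : 0 < ε) (hε1 : ε ≤ 1)
    {t : ℝ} (ht : t ∈ Icc 0 T) : Real.exp (-2 * g t) ≤ expNegConst T / max √t ε := by
  rcases le_total √t ε with h1 | h1
  · rw [max_eq_right h1]; exact h.exp_neg_le_div hT hε hε1 ht
  · rw [max_eq_left h1]
    have h0 : 0 < √t := hε.trans_le h1
    have h2 := h.sqrt_le t ht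
    rw [show -2 * g t = -(2 * g t) by ring, Real.exp_neg, ← one_div]
    exact div_le_div₀ (by linarith [one_le_expNegConst T]) (one_le_expNegConst T) h0 h2

/-- The crude bound `|y| ≤ e^{2y} + e^{-2y}` for the values of the profile. -/
lemma abs_le (h : IsProfile T (coef ε) g) (hT : 0 < T) (hε : 0 < ε) (hε1 : ε ≤ 1) {t : ℝ}
    (ht : t ∈ Icc 0 T) : |g t| ≤ (√T + expNegConst T) * (ε ^ 2)⁻¹ := by
  have h1 := h.exp_neg_le_div hT hε hε1 ht
  have h2 := h.exp_le hT (coef_pos hε) ht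
  have h3 := Real.add_one_le_exp (2 * g t)
  have h4 := Real.add_one_le_exp (-2 * g t)
  have hA := one_le_expNegConst T
  have hsT := Real.sqrt_nonneg T
  have h5 : expNegConst T / ε ≤ expNegConst T * (ε ^ 2)⁻¹ := by
    rw [← div_eq_mul_inv]
    refine div_le_div_of_nonneg_left (by linarith) (by positivity) ?_
    nlinarith
  have h6 : √T ≤ √T * (ε ^ 2)⁻¹ :=
    le_mul_of_one_le_right hsT ((one_le_inv₀ (by positivity)).2 (pow_le_one₀ hε.le hε1))
  have h7 : 0 ≤ expNegConst T * (ε ^ 2)⁻¹ := mul_nonneg (by linarith) (by positivity)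
  rw [add_mul, _root_.abs_le]
  constructor <;> nlinarith

end IsProfile

/-! ### Bounds for the derivatives of the profile -/

lemma abs_iteratedDerivWithin_exp_le {g : ℝ → ℝ} {s : Set ℝ} (hs : UniqueDiffOn ℝ s)
    (hg : ContDiffOn ℝ ∞ g s) {a t D : ℝ} (ha : |a| = 2) (ht : t ∈ s) {n : ℕ}
    (hD : ∀ i, 1 ≤ i → i ≤ n → |iteratedDerivWithin i g s t| ≤ D ^ i) :
    |iteratedDerivWithin n (fun x => Real.exp (a * g x)) s t| ≤
      n.factorial * (2 ^ n * Real.exp (a * g t)) * D ^ n := by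
  have houter : ∀ i (y : ℝ),
      iteratedDeriv i (fun y => Real.exp (a * y)) y = a ^ i * Real.exp (a * y) := fun i y => by
    rw [iteratedDeriv_exp_const_mul]
  have := norm_iteratedFDerivWithin_comp_le (n := n) (N := ∞) (g := fun y => Real.exp (a * y))
    (f := g) (s := s) (t := univ) (x := t) (C := 2 ^ n * Real.exp (a * g t)) (D := D)
    (by fun_prop : ContDiff ℝ ∞ fun y : ℝ => Real.exp (a * y)).contDiffOn hg
    (by exact_mod_cast le_top) uniqueDiffOn_univ hs (mapsTo_univ _ _) ht (fun i hi => ?_)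
    (fun i h1 hi => ?_)
  · rw [norm_iteratedFDerivWithin_eq_norm_iteratedDerivWithin] at this
    exact this
  · rw [norm_iteratedFDerivWithin_eq_norm_iteratedDerivWithin, iteratedDerivWithin_univ, houter,
      norm_mul, norm_pow, Real.norm_eq_abs, ha, Real.norm_eq_abs, Real.abs_exp]
    gcongr
    norm_num
  · rw [norm_iteratedFDerivWithin_eq_norm_iteratedDerivWithin]
    exact hD i h1 hi

lemma iteratedDerivWithin_id_mul {f : ℝ → ℝ} {s : Set ℝ} (hs : UniqueDiffOn ℝ s)
    (hf : ContDiffOn ℝ ∞ f s) (n : ℕ) :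
    EqOn (iteratedDerivWithin n (fun t => t * f t) s)
      (fun t => t * iteratedDerivWithin n f s t + n * iteratedDerivWithin (n - 1) f s t) s := by
  induction n with
  | zero => intro t _; simp
  | succ n ih =>
    intro t ht
    rw [iteratedDerivWithin_succ, derivWithin_congr ih (ih ht)]
    have h1 := (hasDerivWithinAt_id t s).mul (hasDerivWithinAt_iteratedDerivWithin hs hf n ht)
    rcases n with _ | n
    · have := h1.derivWithin (hs t ht)
      simp at this ⊢
      rw [show (fun x => x * f x) = id * f from rfl, this]
      ring
    · have h2 := (hasDerivWithinAt_iteratedDerivWithin hs hf n ht).const_mul ((n + 1 : ℕ) : ℝ)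
      have := (h1.add h2).derivWithin (hs t ht)
      simp only [add_tsub_cancel_right]
      refine Eq.trans this ?_
      simp only [id]
      push_cast
      ring

namespace IsProfile

variable {T ε : ℝ} {g : ℝ → ℝ}

/-- Bounds `O(Dⁱ)`, `D = C / (ε m)`, for the derivatives of the profile pass to the source. In the
Leibniz rule for `t e^{-2g}` the term that lacks the factor `t` has one power of `D` less, which
makes up for the bound `e^{-2g} = O(1 / m)`. -/
lemma abs_iteratedDerivWithin_source_le (h : IsProfile T (coef ε) g) (hT : 0 < T) (hε : 0 < ε)
    (hε1 : ε ≤ 1) {t : ℝ} (ht : t ∈ Icc 0 T) {n : ℕ} {C : ℝ} (hC : 1 ≤ C)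
    (hD : ∀ i, 1 ≤ i → i ≤ n →
      |iteratedDerivWithin i g (Icc 0 T) t| ≤ (C / (ε * max √t ε)) ^ i) :
    |iteratedDerivWithin n (fun s => source (coef ε) s (g s)) (Icc 0 T) t| ≤
      coef ε * (n.factorial * 2 ^ n * (2 * √T + expNegConst T)) * (C / (ε * max √t ε)) ^ n := by
  have hu := uniqueDiffOn_Icc hT
  have hc := coef_pos hε
  set m := max √t ε
  have hm : 0 < m := lt_max_of_lt_right hε
  set D := C / (ε * m) with hDdef
  have hD0 : 0 < D := by positivity
  have he1 : ContDiffOn ℝ ∞ (fun s => Real.exp (2 * g s)) (Icc 0 T) :=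
    (contDiffOn_const.mul h.contDiffOn).exp
  have he2 : ContDiffOn ℝ ∞ (fun s => Real.exp (-2 * g s)) (Icc 0 T) :=
    (contDiffOn_const.mul h.contDiffOn).exp
  have hn : ((n : ℕ) : ℕ∞ω) ≤ ∞ := by exact_mod_cast le_top
  have hsplit : iteratedDerivWithin n (fun s => source (coef ε) s (g s)) (Icc 0 T) t =
      coef ε * (iteratedDerivWithin n (fun s => Real.exp (2 * g s)) (Icc 0 T) t -
        (t * iteratedDerivWithin n (fun s => Real.exp (-2 * g s)) (Icc 0 T) t +
          n * iteratedDerivWithin (n - 1) (fun s => Real.exp (-2 * g s)) (Icc 0 T) t)) := by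
    unfold source
    rw [iteratedDerivWithin_const_mul_field]
    congr 1
    refine (iteratedDerivWithin_sub ht hu ((he1.of_le hn) t ht)
      (((contDiffOn_id.mul he2).of_le hn) t ht)).trans ?_
    congr 1
    exact iteratedDerivWithin_id_mul hu he2 n ht
  have b1 := abs_iteratedDerivWithin_exp_le hu h.contDiffOn (a := 2) (by norm_num) ht hD
  have b2 := abs_iteratedDerivWithin_exp_le hu h.contDiffOn (a := -2) (by norm_num) ht hD
  have b3 := abs_iteratedDerivWithin_exp_le hu h.contDiffOn (a := -2) (n := n - 1) (by norm_num) ht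
    fun i h1 h2 => hD i h1 (h2.trans (Nat.sub_le n 1))
  have e1 := h.exp_le hT hc ht
  have e2 : t * Real.exp (-2 * g t) ≤ √T := (h.mul_exp_neg_le ht).trans (Real.sqrt_le_sqrt ht.2)
  have e3 := h.exp_neg_le_div_max hT hε hε1 ht
  have hA := one_le_expNegConst T
  have hN : (0 : ℝ) < n.factorial * 2 ^ n := by positivity
  have c1 : |iteratedDerivWithin n (fun s => Real.exp (2 * g s)) (Icc 0 T) t| ≤
      n.factorial * 2 ^ n * √T * D ^ n := by
    refine b1.trans ?_
    rw [← mul_assoc]; gcongr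
  have c2 : t * |iteratedDerivWithin n (fun s => Real.exp (-2 * g s)) (Icc 0 T) t| ≤
      n.factorial * 2 ^ n * √T * D ^ n := by
    calc _ ≤ t * (n.factorial * (2 ^ n * Real.exp (-2 * g t)) * D ^ n) :=
          mul_le_mul_of_nonneg_left b2 ht.1
      _ = n.factorial * 2 ^ n * (t * Real.exp (-2 * g t)) * D ^ n := by ring
      _ ≤ _ := by gcongr
  have c3 : n * |iteratedDerivWithin (n - 1) (fun s => Real.exp (-2 * g s)) (Icc 0 T) t| ≤
      n.factorial * 2 ^ n * expNegConst T * D ^ n := by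
    rcases n with _ | n
    · simp; linarith
    · simp only [add_tsub_cancel_right] at b3 ⊢
      have hmD : expNegConst T / m ≤ expNegConst T * D := by
        rw [hDdef, div_eq_mul_inv]
        gcongr
        rw [← one_div, div_le_div_iff₀ hm (by positivity)]
        calc 1 * (ε * m) = ε * m := one_mul _
          _ ≤ 1 * m := by gcongr
          _ ≤ C * m := by gcongr
      calc _ ≤ ((n + 1 : ℕ) : ℝ) * (n.factorial * (2 ^ n * Real.exp (-2 * g t)) * D ^ n) := by
            gcongr
        _ ≤ ((n + 1 : ℕ) : ℝ) * (n.factorial * (2 ^ n * (expNegConst T * D)) * D ^ n) := by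
            gcongr; exact e3.trans hmD
        _ = (n + 1).factorial * 2 ^ n * expNegConst T * D ^ (n + 1) := by
            rw [Nat.factorial_succ]; push_cast; ring
        _ ≤ _ := by
            gcongr
            · norm_num
            · omega
  rw [hsplit, abs_mul, abs_of_pos hc, mul_assoc (coef ε)]
  refine mul_le_mul_of_nonneg_left ?_ hc.le
  set x := iteratedDerivWithin n (fun s => Real.exp (2 * g s)) (Icc 0 T) t
  set y := iteratedDerivWithin n (fun s => Real.exp (-2 * g s)) (Icc 0 T) t
  set z := iteratedDerivWithin (n - 1) (fun s => Real.exp (-2 * g s)) (Icc 0 T) t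
  calc |x - (t * y + n * z)| ≤ |x| + |t * y + n * z| := abs_sub _ _
    _ ≤ |x| + (|t * y| + |n * z|) := by gcongr; exact abs_add_le _ _
    _ = |x| + (t * |y| + n * |z|) := by
        rw [abs_mul, abs_mul, abs_of_nonneg ht.1, Nat.abs_cast]
    _ ≤ n.factorial * 2 ^ n * √T * D ^ n + (n.factorial * 2 ^ n * √T * D ^ n +
        n.factorial * 2 ^ n * expNegConst T * D ^ n) := by gcongr
    _ = _ := by ring

end IsProfile

/-- The `i`-th derivative of a profile at `t = r²` is `O((ε max(r, ε))⁻ⁱ)`, uniformly in `ε`. For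
`r ≥ ε` the differentiated equation expresses the next derivative through lower ones; for `r ≤ ε`
the next derivative is a mean of derivatives of the source. -/
theorem exists_iteratedDerivWithin_profile_le {T : ℝ} (hT : 0 < T) (n : ℕ) :
    ∃ C : ℝ, 1 ≤ C ∧ ∀ ε : ℝ, 0 < ε → ε ≤ 1 → ∀ g : ℝ → ℝ, IsProfile T (coef ε) g →
      ∀ t ∈ Icc 0 T, ∀ i, 1 ≤ i → i ≤ n →
        |iteratedDerivWithin i g (Icc 0 T) t| ≤ (C / (ε * max √t ε)) ^ i := by
  induction n with
  | zero => exact ⟨1, le_rfl, fun _ _ _ _ _ _ _ i h1 h2 => by omega⟩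
  | succ n ih =>
    obtain ⟨C, hC, hCb⟩ := ih
    have hpi := Real.pi_pos
    have hsT := Real.sqrt_pos.2 hT
    have hA := one_le_expNegConst T
    -- a bound for `ε² f⁽ʲ⁾`, `j ≤ n`, in units of `(ε m)⁻ʲ`
    set B : ℝ := Real.pi ^ 2 * (n.factorial * 2 ^ n * (2 * √T + expNegConst T)) * C ^ n with hB
    have hB0 : 0 < B := by positivity
    -- the same for `j = n - 1`
    set B' : ℝ := Real.pi ^ 2 * ((n - 1).factorial * 2 ^ (n - 1) * (2 * √T + expNegConst T)) *
      C ^ (n - 1) with hB'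
    have hB'0 : 0 < B' := by positivity
    set K : ℝ := 1 + C + B + (B' + n * C ^ n * (√T + 1)) + Real.pi * (1 + √T) with hK
    have hnC : 0 ≤ n * C ^ n * (√T + 1) := by positivity
    have hpiT : 0 < Real.pi * (1 + √T) := by positivity
    have hK1 : 1 ≤ K := by rw [hK]; linarith
    refine ⟨K, hK1, fun ε hε hε1 g hg t ht i h1 hi => ?_⟩
    have hCt := hCb ε hε hε1 g hg
    set m := max √t ε with hm'
    have hm : 0 < m := lt_max_of_lt_right hε
    have hεm : 0 < ε * m := by positivity
    rcases hi.lt_or_eq with hlt | rfl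
    · refine (hCt t ht i h1 (by omega)).trans ?_
      have : C ≤ K := by rw [hK]; linarith
      gcongr
    suffices hs : |iteratedDerivWithin (n + 1) g (Icc 0 T) t| ≤ K / (ε * m) ^ (n + 1) by
      refine hs.trans ?_
      rw [div_pow]
      gcongr
      exact le_self_pow₀ hK1 (by omega)
    rcases le_or_gt √t ε with hle | hgt
    · have hmε : m = ε := max_eq_right hle
      rw [hg.iteratedDerivWithin_succ hT n ht]
      have hb : |momentMean n
          (iteratedDerivWithin n (fun s => source (coef ε) s (g s)) (Icc 0 T)) t| ≤
          B / (ε * m) ^ (n + 1) := by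
        refine abs_momentMean_le ht.1 fun s hs => ?_
        have hs' : s ∈ Icc 0 T := ⟨hs.1, hs.2.trans ht.2⟩
        refine (hg.abs_iteratedDerivWithin_source_le hT hε hε1 hs' hC (hCt s hs')).trans
          (le_of_eq ?_)
        rw [max_eq_right ((Real.sqrt_le_sqrt hs.2).trans hle), hmε, coef, hB, div_pow]
        field_simp
        ring
      refine hb.trans ?_
      have : B ≤ K := by rw [hK]; linarith
      gcongr
    · have hmt : m = √t := max_eq_left hgt.le
      have ht2 : t = m ^ 2 := by rw [hmt, Real.sq_sqrt ht.1]
      have hmT : m ≤ √T := by rw [hmt]; exact Real.sqrt_le_sqrt ht.2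
      rcases n with _ | n
      · have h1 := hg.mul_deriv_sq_le hT (coef_pos hε) ht
        have h2 : |iteratedDerivWithin 1 g (Icc 0 T) t| ≤ Real.pi * (1 + √T) / (ε * m) := by
          refine abs_le_of_sq_le_sq ?_ (by positivity)
          rw [div_pow, le_div_iff₀ (by positivity)]
          rw [ht2, coef] at h1
          calc iteratedDerivWithin 1 g (Icc 0 T) t ^ 2 * (ε * m) ^ 2
              = (m ^ 2 * iteratedDerivWithin 1 g (Icc 0 T) t ^ 2) * ε ^ 2 := by ring
            _ ≤ (Real.pi ^ 2 * (ε ^ 2)⁻¹ * √T) * ε ^ 2 := by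
                rw [ht2]; gcongr
            _ = Real.pi ^ 2 * √T := by field_simp
            _ ≤ Real.pi ^ 2 * (1 + √T) ^ 2 := by gcongr; nlinarith
            _ = _ := by ring
        simp only [zero_add, pow_one]
        refine h2.trans ?_
        have : Real.pi * (1 + √T) ≤ K := by rw [hK]; linarith
        gcongr
      · have hode := hg.mul_iteratedDerivWithin hT n ht
        have hf := hg.abs_iteratedDerivWithin_source_le hT hε hε1 ht hC
          (n := n) (fun i h1 h2 => hCt t ht i h1 (by omega))
        have hprev := hCt t ht (n + 1) (by omega) le_rfl
        rw [← hm', div_pow] at hf hprev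
        set x := iteratedDerivWithin (n + 2) g (Icc 0 T) t
        set y := iteratedDerivWithin (n + 1) g (Icc 0 T) t
        set z := iteratedDerivWithin n (fun s => source (coef ε) s (g s)) (Icc 0 T) t
        have hx : m ^ 2 * |x| ≤ |z| + (n + 1) * |y| := by
          have hx1 : m ^ 2 * x = z - (n + 1) * y := by rw [← ht2]; linarith
          calc m ^ 2 * |x| = |m ^ 2 * x| := by rw [abs_mul, abs_of_nonneg (sq_nonneg m)]
            _ ≤ |z| + |(n + 1) * y| := by rw [hx1]; exact abs_sub _ _
            _ = _ := by
                rw [abs_mul, abs_of_nonneg (by positivity : (0 : ℝ) ≤ n + 1)]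
        rw [le_div_iff₀ (by positivity)]
        simp only [add_tsub_cancel_right] at hB'
        have hz : |z| * (ε ^ 2 * (ε * m) ^ n) ≤ B' := by
          calc |z| * (ε ^ 2 * (ε * m) ^ n) ≤ _ := mul_le_mul_of_nonneg_right hf (by positivity)
            _ = B' := by rw [hB', coef]; field_simp
        have hy : |y| * (ε * m) ^ (n + 1) ≤ C ^ (n + 1) := by
          rwa [le_div_iff₀ (by positivity)] at hprev
        have hεmT : ε * m ≤ √T + 1 := by nlinarith
        calc |x| * (ε * m) ^ (n + 1 + 1) = (m ^ 2 * |x|) * (ε ^ 2 * (ε * m) ^ n) := by ring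
          _ ≤ (|z| + (n + 1) * |y|) * (ε ^ 2 * (ε * m) ^ n) := by gcongr
          _ = |z| * (ε ^ 2 * (ε * m) ^ n) + (n + 1) * (|y| * (ε * m) ^ (n + 1)) * (ε / m) := by
              field_simp
              ring
          _ ≤ B' + (n + 1) * C ^ (n + 1) * 1 := by
              gcongr
              rw [div_le_one hm, hmt]; exact hgt.le
          _ ≤ K := by
              have : (n + 1) * C ^ (n + 1) * 1 ≤ ((n + 1 : ℕ) : ℝ) * C ^ (n + 1) * (√T + 1) := by
                push_cast; gcongr; linarith
              rw [hK]; linarith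

/-! ### The Laplacian, radial solutions and uniqueness -/

section Laplacian

variable {E : Type*} [NormedAddCommGroup E] [NormedSpace ℝ E]

lemma eventually_hasDerivAt_line {f : E → ℝ} {x : E} (hf : ContDiffAt ℝ 2 f x) (e : E) :
    ∀ᶠ s in 𝓝 (0 : ℝ), HasDerivAt (fun s : ℝ => f (x + s • e)) (fderiv ℝ f (x + s • e) e) s := by
  have hc : Tendsto (fun s : ℝ => x + s • e) (𝓝 0) (𝓝 x) := by
    have : Continuous fun s : ℝ => x + s • e := by fun_prop
    simpa using this.tendsto 0
  filter_upwards [hc.eventually (hf.eventually (by simp))] with s hs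
  have h1 : HasDerivAt (fun s : ℝ => x + s • e) e s := by
    simpa using ((hasDerivAt_id s).smul_const e).const_add x
  exact (hs.differentiableAt two_ne_zero).hasFDerivAt.comp_hasDerivAt s h1

lemma hasDerivAt_fderiv_line {f : E → ℝ} {x : E} (hf : ContDiffAt ℝ 2 f x) (e : E) :
    HasDerivAt (fun s : ℝ => fderiv ℝ f (x + s • e) e) (iteratedFDeriv ℝ 2 f x ![e, e]) 0 := by
  have h2 : DifferentiableAt ℝ (fderiv ℝ f) (x + (0 : ℝ) • e) := by
    rw [zero_smul, add_zero]
    exact (hf.fderiv_right (m := 1) (by norm_num)).differentiableAt one_ne_zero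
  have h1 : HasDerivAt (fun s : ℝ => x + s • e) e 0 := by
    simpa using ((hasDerivAt_id (0 : ℝ)).smul_const e).const_add x
  have h3 : HasDerivAt (fun s : ℝ => fderiv ℝ f (x + s • e))
      (fderiv ℝ (fderiv ℝ f) (x + (0 : ℝ) • e) e) 0 := h2.hasFDerivAt.comp_hasDerivAt (0 : ℝ) h1
  have h4 : HasDerivAt (fun s : ℝ => fderiv ℝ f (x + s • e) e)
      (fderiv ℝ (fderiv ℝ f) (x + (0 : ℝ) • e) e e) 0 :=
    (ContinuousLinearMap.apply ℝ ℝ e).hasFDerivAt.comp_hasDerivAt (0 : ℝ) h3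
  refine h4.congr_deriv ?_
  rw [iteratedFDeriv_two_apply, zero_smul, add_zero]
  rfl

end Laplacian

lemma laplacian_plane (f : Plane → ℝ) (x : Plane) :
    Δ f x = ∑ i, iteratedFDeriv ℝ 2 f x
      ![EuclideanSpace.single i (1 : ℝ), EuclideanSpace.single i (1 : ℝ)] := by
  rw [InnerProductSpace.laplacian_eq_iteratedFDeriv_orthonormalBasis f
    (EuclideanSpace.basisFun (Fin 2) ℝ)]
  simp

lemma laplacian_nonpos_of_isLocalMax {f : Plane → ℝ} {x : Plane} (hf : ContDiffAt ℝ 2 f x)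
    (h : IsLocalMax f x) : Δ f x ≤ 0 := by
  rw [laplacian_plane]
  refine Finset.sum_nonpos fun i _ => ?_
  refine second_deriv_nonpos_of_isLocalMax (eventually_hasDerivAt_line hf _)
    (hasDerivAt_fderiv_line hf _) ?_
  have hc : Tendsto (fun s : ℝ => x + s • EuclideanSpace.single i (1 : ℝ)) (𝓝 0) (𝓝 x) := by
    have : Continuous fun s : ℝ => x + s • EuclideanSpace.single i (1 : ℝ) := by fun_prop
    simpa using this.tendsto 0
  have : ∀ᶠ y in 𝓝 x, f y ≤ f x := h
  simpa [IsLocalMax, IsMaxFilter] using hc.eventually this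

/-- The Laplacian of `G (|x|²)` in the plane, including the origin. -/
lemma laplacian_comp_norm_sq {G : ℝ → ℝ} (hG : ContDiff ℝ 2 G) (x : Plane) :
    Δ (fun y : Plane => G (‖y‖ ^ 2)) x =
      4 * (‖x‖ ^ 2 * iteratedDeriv 2 G (‖x‖ ^ 2) + deriv G (‖x‖ ^ 2)) := by
  have hu : ContDiff ℝ 2 (fun y : Plane => G (‖y‖ ^ 2)) := hG.comp (contDiff_norm_sq ℝ)
  have hG1 : ∀ s, HasDerivAt G (deriv G s) s := fun s =>
    (hG.differentiable two_ne_zero s).hasDerivAt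
  have hG2 : ∀ s, HasDerivAt (deriv G) (iteratedDeriv 2 G s) s := fun s => by
    have := hG.differentiable_iteratedDeriv 1 (by norm_num) s
    rw [iteratedDeriv_one] at this
    rw [iteratedDeriv_succ, iteratedDeriv_one]
    exact this.hasDerivAt
  have key : ∀ i, iteratedFDeriv ℝ 2 (fun y : Plane => G (‖y‖ ^ 2)) x
      ![EuclideanSpace.single i (1 : ℝ), EuclideanSpace.single i (1 : ℝ)] =
      4 * x i ^ 2 * iteratedDeriv 2 G (‖x‖ ^ 2) + 2 * deriv G (‖x‖ ^ 2) := by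
    intro i
    set e : Plane := EuclideanSpace.single i (1 : ℝ)
    have hline : ∀ s : ℝ, ‖x + s • e‖ ^ 2 = ‖x‖ ^ 2 + (2 * x i * s + s ^ 2) := fun s => by
      rw [norm_add_sq_real, inner_smul_right, EuclideanSpace.inner_single_right, norm_smul]
      simp [e]; ring
    have hq : ∀ s : ℝ, HasDerivAt (fun s : ℝ => ‖x‖ ^ 2 + (2 * x i * s + s ^ 2))
        (2 * x i + 2 * s) s := fun s => by
      refine ((((hasDerivAt_id s).const_mul (2 * x i)).add (hasDerivAt_pow 2 s)).const_add
        (‖x‖ ^ 2)).congr_deriv ?_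
      simp
    have hd1 : ∀ s : ℝ, HasDerivAt (fun s : ℝ => G (‖x + s • e‖ ^ 2))
        (deriv G (‖x‖ ^ 2 + (2 * x i * s + s ^ 2)) * (2 * x i + 2 * s)) s := fun s => by
      simp only [hline]
      exact (hG1 _).comp s (hq s)
    have heq : (fun s : ℝ => fderiv ℝ (fun y : Plane => G (‖y‖ ^ 2)) (x + s • e) e) =ᶠ[𝓝 0]
        fun s => deriv G (‖x‖ ^ 2 + (2 * x i * s + s ^ 2)) * (2 * x i + 2 * s) := by
      filter_upwards [eventually_hasDerivAt_line hu.contDiffAt e] with s hs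
      exact hs.unique (hd1 s)
    have hd2 := (hasDerivAt_fderiv_line (x := x) hu.contDiffAt e).congr_of_eventuallyEq heq.symm
    have hd3 : HasDerivAt (fun s : ℝ =>
        deriv G (‖x‖ ^ 2 + (2 * x i * s + s ^ 2)) * (2 * x i + 2 * s)) _ 0 :=
      ((hG2 _).comp (0 : ℝ) (hq 0)).mul (((hasDerivAt_id (0 : ℝ)).const_mul 2).const_add (2 * x i))
    rw [hd2.unique hd3]
    simp
    ring
  rw [laplacian_plane, Fin.sum_univ_two, key, key, EuclideanSpace.real_norm_sq_eq,
    Fin.sum_univ_two]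
  ring

/-- Comparison of classical solutions: at a positive interior maximum of `w - z` the strictly
increasing nonlinearity would make `Δ (w - z)` positive. -/
lemma IsClassicalSolution.le {r₀ ε : ℝ} (hε : 0 < ε) {w z : Plane → ℝ}
    (hw : IsClassicalSolution r₀ ε w) (hz : IsClassicalSolution r₀ ε z) {x : Plane}
    (hx : x ∈ Metric.closedBall 0 (2 * r₀)) : w x ≤ z x := by
  obtain ⟨y, hy, hmax⟩ := (isCompact_closedBall (0 : Plane) (2 * r₀)).exists_isMaxOn ⟨x, hx⟩
    (hw.continuousOn.sub hz.continuousOn)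
  have hxy : w x - z x ≤ w y - z y := hmax hx
  suffices w y - z y ≤ 0 by linarith
  by_contra! hpos
  have hyb : y ∈ Metric.ball (0 : Plane) (2 * r₀) := by
    rcases (Metric.mem_closedBall.1 hy).eq_or_lt with h | h
    · rw [hw.boundary y h, hz.boundary y h, sub_self] at hpos
      exact absurd hpos (lt_irrefl _)
    · exact h
  have hnhds := Metric.isOpen_ball.mem_nhds hyb
  have hwy := hw.contDiffOn.contDiffAt hnhds
  have hzy := hz.contDiffOn.contDiffAt hnhds
  have hloc : IsLocalMax (w - z) y :=
    hmax.isLocalMax (Filter.mem_of_superset hnhds Metric.ball_subset_closedBall)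
  have hle : Δ (w - z) y ≤ 0 := laplacian_nonpos_of_isLocalMax (hwy.sub hzy) hloc
  rw [hwy.laplacian_sub hzy, hw.equation y hyb, hz.equation y hyb, ← mul_sub] at hle
  have h1 : Real.exp (2 * z y) < Real.exp (2 * w y) := Real.exp_lt_exp.2 (by linarith)
  have h2 : ‖y‖ ^ 2 * Real.exp (-2 * w y) ≤ ‖y‖ ^ 2 * Real.exp (-2 * z y) :=
    mul_le_mul_of_nonneg_left (Real.exp_le_exp.2 (by linarith)) (sq_nonneg _)
  have h3 : 0 < 4 * Real.pi ^ 2 * (ε ^ 2)⁻¹ := by have := Real.pi_pos; positivity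
  have h4 : 0 < Real.exp (2 * w y) - ‖y‖ ^ 2 * Real.exp (-2 * w y) -
      (Real.exp (2 * z y) - ‖y‖ ^ 2 * Real.exp (-2 * z y)) := by linarith
  exact absurd (mul_pos h3 h4) (not_lt.2 hle)

lemma mapsTo_norm_sq_closedBall (R : ℝ) :
    MapsTo (fun x : Plane => ‖x‖ ^ 2) (Metric.closedBall 0 R) (Icc 0 (R ^ 2)) := fun x hx => by
  rw [mem_closedBall_zero_iff] at hx
  exact ⟨sq_nonneg _, pow_le_pow_left₀ (norm_nonneg _) hx 2⟩

lemma IsProfile.contDiffOn_comp_norm_sq {R c : ℝ} {g : ℝ → ℝ} (h : IsProfile (R ^ 2) c g) :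
    ContDiffOn ℝ ∞ (fun x : Plane => g (‖x‖ ^ 2)) (Metric.closedBall 0 R) :=
  h.contDiffOn.comp (contDiff_norm_sq ℝ).contDiffOn (mapsTo_norm_sq_closedBall R)

lemma IsProfile.isClassicalSolution {r₀ ε : ℝ} (hr₀ : 0 < r₀) {g : ℝ → ℝ}
    (h : IsProfile ((2 * r₀) ^ 2) (coef ε) g) :
    IsClassicalSolution r₀ ε fun x => g (‖x‖ ^ 2) := by
  set T := (2 * r₀) ^ 2 with hTdef
  have hT : 0 < T := by positivity
  have hu := uniqueDiffOn_Icc hT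
  have hsm := h.contDiffOn_comp_norm_sq.mono Metric.ball_subset_closedBall
  refine ⟨contDiffOn_infty.1 hsm 2, h.contDiffOn_comp_norm_sq.continuousOn, fun x hx => ?_,
    fun x hx => ?_⟩
  · obtain ⟨G, hG, hGe⟩ := exists_contDiff_eqOn_Icc hT 2
      (contDiffOn_infty.1 h.contDiffOn 2)
    have hG : ContDiff ℝ 2 G := by exact_mod_cast hG
    have hx' : ‖x‖ ^ 2 ∈ Icc 0 T :=
      mapsTo_norm_sq_closedBall _ (Metric.ball_subset_closedBall hx)
    have heq : (fun x : Plane => g (‖x‖ ^ 2)) =ᶠ[𝓝 x] fun x => G (‖x‖ ^ 2) := by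
      filter_upwards [Metric.isOpen_ball.mem_nhds hx] with y hy
      exact (hGe (mapsTo_norm_sq_closedBall _ (Metric.ball_subset_closedBall hy))).symm
    rw [(InnerProductSpace.laplacian_congr_nhds heq).eq_of_nhds, laplacian_comp_norm_sq hG]
    have h1 := iteratedDerivWithin_eq_of_eqOn (n := 1) hu (hG.of_le (by norm_num)) hGe hx'
    have h2 := iteratedDerivWithin_eq_of_eqOn (n := 2) hu (by exact_mod_cast hG) hGe hx'
    have hode := h.mul_iteratedDerivWithin hT 0 hx'
    rw [iteratedDeriv_one] at h1
    rw [h1, h2]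
    simp only [zero_add, Nat.cast_zero, one_mul, iteratedDerivWithin_zero] at hode
    rw [hode, source, coef]
    ring
  · rw [mem_sphere_zero_iff_norm] at hx
    rw [hx, h.boundary, hTdef, Real.log_pow]
    push_cast
    ring

/-! ### Cartesian derivatives of the radial solution -/

/-- A form of the norm bound for derivatives of a composition in which the outer derivatives may
grow like `l⁻ⁱ`, provided that the inner ones carry a factor `l`. -/
lemma norm_iteratedFDeriv_comp_le_of_scale {E : Type*} [NormedAddCommGroup E] [NormedSpace ℝ E]
    {g : ℝ → ℝ} {f : E → ℝ} {s : Set E} {a b C D l : ℝ} {x : E} {n : ℕ} (hab : a < b) (hl : 0 < l)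
    (hg : ContDiffOn ℝ ∞ g (Icc a b)) (hf : ContDiff ℝ ∞ f) (hs : IsOpen s)
    (hst : MapsTo f s (Icc a b)) (hx : x ∈ s)
    (hC : ∀ i ≤ n, l ^ i * |iteratedDerivWithin i g (Icc a b) (f x)| ≤ C)
    (hD : ∀ i, 1 ≤ i → i ≤ n → ‖iteratedFDeriv ℝ i f x‖ ≤ l * D ^ i) :
    ‖iteratedFDeriv ℝ n (fun x => g (f x)) x‖ ≤ n.factorial * C * D ^ n := by
  let L : ℝ →L[ℝ] ℝ := l • ContinuousLinearMap.id ℝ ℝ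
  have hL : ∀ y, L y = l * y := fun y => rfl
  have hLn : ‖L‖ ≤ l := by
    refine ContinuousLinearMap.opNorm_le_bound _ hl.le fun y => ?_
    rw [hL, norm_mul, Real.norm_eq_abs, abs_of_pos hl]
  have hpre : L ⁻¹' Icc a b = Icc (a / l) (b / l) := by
    ext y
    simp only [mem_preimage, hL, mem_Icc, div_le_iff₀ hl, le_div_iff₀ hl, mul_comm]
  have hu : UniqueDiffOn ℝ (Icc a b) := uniqueDiffOn_Icc hab
  have hu' : UniqueDiffOn ℝ (L ⁻¹' Icc a b) := by
    rw [hpre]; exact uniqueDiffOn_Icc (by gcongr)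
  have hLf : ∀ y, L (l⁻¹ * f y) = f y := fun y => by rw [hL, mul_inv_cancel_left₀ hl.ne']
  have hcomp : (fun x => g (f x)) = (g ∘ L) ∘ fun x => l⁻¹ * f x := by
    funext y; simp only [Function.comp, hLf]
  have := norm_iteratedFDerivWithin_comp_le (n := n) (N := ∞) (g := g ∘ L)
    (f := fun x => l⁻¹ * f x) (s := s) (t := L ⁻¹' Icc a b) (x := x) (C := C) (D := D)
    (hg.comp L.contDiff.contDiffOn fun y hy => hy) (contDiff_const.mul hf).contDiffOn
    (by exact_mod_cast le_top) hu' hs.uniqueDiffOn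
    (fun y hy => by rw [mem_preimage, hLf]; exact hst hy) hx (fun i hi => ?_) (fun i h1 hi => ?_)
  · rwa [iteratedFDerivWithin_of_isOpen n hs hx, ← hcomp] at this
  · rw [L.iteratedFDerivWithin_comp_right hg hu hu' (by rw [hLf]; exact hst hx)
      (by exact_mod_cast le_top), hLf]
    refine (ContinuousMultilinearMap.norm_compContinuousLinearMap_le _ _).trans ?_
    rw [norm_iteratedFDerivWithin_eq_norm_iteratedDerivWithin, Finset.prod_const,
      Finset.card_univ, Fintype.card_fin, mul_comm]
    refine le_trans ?_ (hC i hi)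
    rw [Real.norm_eq_abs]
    gcongr
  · rw [iteratedFDerivWithin_of_isOpen i hs hx]
    have h1' : iteratedFDeriv ℝ i (fun x => l⁻¹ * f x) x = l⁻¹ • iteratedFDeriv ℝ i f x :=
      iteratedFDeriv_const_smul_apply (a := l⁻¹) ((hf.of_le (by exact_mod_cast le_top)).contDiffAt)
    rw [h1', norm_smul, Real.norm_eq_abs, abs_of_pos (inv_pos.2 hl)]
    calc l⁻¹ * ‖iteratedFDeriv ℝ i f x‖ ≤ l⁻¹ * (l * D ^ i) := by
          have := hD i h1 hi
          gcongr
      _ = D ^ i := by field_simp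

lemma norm_iteratedFDeriv_one_norm_sq_le (x : Plane) :
    ‖iteratedFDeriv ℝ 1 (fun y : Plane => ‖y‖ ^ 2) x‖ ≤ 2 * ‖x‖ := by
  rw [← norm_iteratedFDeriv_fderiv, norm_iteratedFDeriv_zero, fderiv_norm_sq_apply]
  refine (norm_nsmul_le).trans ?_
  rw [innerSL_apply_norm]
  norm_num

lemma norm_iteratedFDeriv_two_norm_sq_le (x : Plane) :
    ‖iteratedFDeriv ℝ 2 (fun y : Plane => ‖y‖ ^ 2) x‖ ≤ 2 := by
  rw [← norm_iteratedFDeriv_fderiv, fderiv_norm_sq, ← norm_iteratedFDeriv_fderiv,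
    norm_iteratedFDeriv_zero]
  have h : fderiv ℝ (2 • ⇑(innerSL ℝ (E := Plane))) x = 2 • innerSL ℝ (E := Plane) :=
    (2 • innerSL ℝ (E := Plane)).fderiv
  rw [h]
  refine ContinuousLinearMap.opNorm_le_bound _ (by norm_num) fun y => ?_
  have := norm_nsmul_le (n := 2) (a := innerSL ℝ y)
  rw [innerSL_apply_norm] at this
  exact_mod_cast this

lemma norm_iteratedFDeriv_norm_sq_eq_zero (n : ℕ) (x : Plane) :
    ‖iteratedFDeriv ℝ (n + 3) (fun y : Plane => ‖y‖ ^ 2) x‖ = 0 := by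
  rw [← norm_iteratedFDeriv_fderiv, fderiv_norm_sq, ← norm_iteratedFDeriv_fderiv]
  have h : fderiv ℝ (2 • ⇑(innerSL ℝ (E := Plane))) = fun _ => 2 • innerSL ℝ (E := Plane) :=
    funext fun x => (2 • innerSL ℝ (E := Plane)).fderiv
  rw [h, iteratedFDeriv_succ_const, Pi.zero_apply, norm_zero]

/-- The chain rule for `u (x) = g (|x|²)` with the scale `l = ε max(|x|, ε)`: the derivatives of
`g` are `O(l⁻ⁱ)`, and those of `|x|²` are at most `l (2/ε)ⁱ`. -/
theorem exists_norm_iteratedFDeriv_profile_le {R : ℝ} (hR : 0 < R) (n : ℕ) :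
    ∃ C : ℝ, 0 < C ∧ ∀ ε : ℝ, 0 < ε → ε ≤ 1 → ∀ g : ℝ → ℝ, IsProfile (R ^ 2) (coef ε) g →
      ∀ x ∈ Metric.ball (0 : Plane) R,
        ‖iteratedFDeriv ℝ n (fun x : Plane => g (‖x‖ ^ 2)) x‖ ≤ C * ((ε ^ 2)⁻¹ * (ε ^ n)⁻¹) := by
  have hT : 0 < R ^ 2 := by positivity
  obtain ⟨C, hC, hCb⟩ := exists_iteratedDerivWithin_profile_le hT n
  have hA := one_le_expNegConst (R ^ 2)
  have hsT := Real.sqrt_nonneg (R ^ 2)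
  set K := √(R ^ 2) + expNegConst (R ^ 2) + C ^ n with hK
  have hK0 : 0 < K := by positivity
  refine ⟨n.factorial * K * 2 ^ n, by positivity, fun ε hε hε1 g hg x hx => ?_⟩
  set m := max ‖x‖ ε
  have hm : 0 < m := lt_max_of_lt_right hε
  have hεm : 0 < ε * m := by positivity
  have hxt : ‖x‖ ^ 2 ∈ Icc 0 (R ^ 2) :=
    mapsTo_norm_sq_closedBall R (Metric.ball_subset_closedBall hx)
  have hε2 : 1 ≤ (ε ^ 2)⁻¹ := (one_le_inv₀ (by positivity)).2 (pow_le_one₀ hε.le hε1)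
  have := norm_iteratedFDeriv_comp_le_of_scale (g := g) (f := fun y : Plane => ‖y‖ ^ 2)
    (s := Metric.ball 0 R) (x := x) (n := n) (l := ε * m) (C := K * (ε ^ 2)⁻¹) (D := 2 / ε)
    hT hεm hg.contDiffOn (contDiff_norm_sq ℝ) Metric.isOpen_ball
    (fun y hy => mapsTo_norm_sq_closedBall R (Metric.ball_subset_closedBall hy)) hx
    (fun i hi => ?_) (fun i h1 hi => ?_)
  · refine this.trans (le_of_eq ?_)
    rw [div_pow]; field_simp
  · rcases Nat.eq_zero_or_pos i with rfl | hi0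
    · rw [iteratedDerivWithin_zero, pow_zero, one_mul]
      refine (hg.abs_le hT hε hε1 hxt).trans ?_
      gcongr
      rw [hK]
      have : 0 < C ^ n := by positivity
      linarith
    · have h2 := hCb ε hε hε1 g hg _ hxt i hi0 hi
      rw [Real.sqrt_sq (norm_nonneg x), div_pow] at h2
      calc (ε * m) ^ i * |iteratedDerivWithin i g (Icc 0 (R ^ 2)) (‖x‖ ^ 2)|
          ≤ (ε * m) ^ i * (C ^ i / (ε * m) ^ i) := by gcongr
        _ = C ^ i := by field_simp
        _ ≤ C ^ n := by gcongr
        _ ≤ K := by rw [hK]; linarith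
        _ ≤ K * (ε ^ 2)⁻¹ := le_mul_of_one_le_right hK0.le hε2
  · have hxm : ‖x‖ ≤ m := le_max_left _ _
    have hεm' : ε ≤ m := le_max_right _ _
    match i, h1 with
    | 1, _ =>
      refine (norm_iteratedFDeriv_one_norm_sq_le x).trans ?_
      rw [pow_one]
      calc 2 * ‖x‖ ≤ 2 * m := by gcongr
        _ = _ := by field_simp
    | 2, _ =>
      refine (norm_iteratedFDeriv_two_norm_sq_le x).trans ?_
      rw [div_pow, mul_div_assoc', le_div_iff₀ (by positivity)]
      nlinarith
    | i + 3, _ =>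
      rw [norm_iteratedFDeriv_norm_sq_eq_zero]; positivity

theorem exists_ckNorm_profile_le {R : ℝ} (hR : 0 < R) (k : ℕ) :
    ∃ C : ℝ, 0 < C ∧ ∀ ε : ℝ, 0 < ε → ε ≤ 1 → ∀ g : ℝ → ℝ, IsProfile (R ^ 2) (coef ε) g →
      ckNorm k (Metric.ball 0 R) (fun x : Plane => g (‖x‖ ^ 2)) ≤
        ENNReal.ofReal (C * ε ^ (-(k : ℤ) - 2)) := by
  choose C hC hCb using fun n => exists_norm_iteratedFDeriv_profile_le hR n
  refine ⟨∑ j ∈ Finset.range (k + 1), C j, Finset.sum_pos (fun j _ => hC j) (by simp),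
    fun ε hε hε1 g hg => ?_⟩
  have hpow : ε ^ (-(k : ℤ) - 2) = (ε ^ 2)⁻¹ * (ε ^ k)⁻¹ := by
    rw [sub_eq_add_neg, zpow_add₀ hε.ne', zpow_neg, zpow_neg, mul_comm]
    norm_cast
  rw [Finset.sum_mul, ENNReal.ofReal_sum_of_nonneg fun j _ =>
    mul_nonneg (hC j).le (zpow_nonneg hε.le _)]
  refine Finset.sum_le_sum fun j hj => iSup_le fun s => iSup₂_le fun x hx => ?_
  have hjk : j ≤ k := Nat.lt_succ_iff.1 (Finset.mem_range.1 hj)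
  rw [← ofReal_norm]
  refine ENNReal.ofReal_le_ofReal ?_
  refine (ContinuousMultilinearMap.le_opNorm _ _).trans ?_
  simp only [PiLp.norm_single, norm_one, Finset.prod_const_one, mul_one]
  refine (hCb j ε hε hε1 g hg x hx).trans ?_
  rw [hpow]
  have h1 : (ε ^ j)⁻¹ ≤ (ε ^ k)⁻¹ :=
    inv_anti₀ (by positivity) (pow_le_pow_of_le_one hε.le hε1 hjk)
  have := hC j
  gcongr

lemma ckNorm_mono {k : ℕ} {Ω Ω' : Set Plane} (h : Ω ⊆ Ω') (u : Plane → ℝ) :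
    ckNorm k Ω u ≤ ckNorm k Ω' u :=
  Finset.sum_le_sum fun _ _ => iSup_mono fun _ => biSup_mono fun _ hx => h hx

/-! ### Exponential decay near the boundary -/

/-- Maximum principle on an interval: `d ≤ 0` at the ends implies `d ≤ 0` inside if
`t d'' + d' > 0` wherever `d > 0`. -/
lemma nonpos_of_operator_pos {a b : ℝ} (ha : 0 < a) {d d1 d2 : ℝ → ℝ}
    (hd : ContinuousOn d (Icc a b)) (hd1 : ∀ t ∈ Ioo a b, HasDerivAt d (d1 t) t)
    (hd2 : ∀ t ∈ Ioo a b, HasDerivAt d1 (d2 t) t) (hda : d a ≤ 0) (hdb : d b ≤ 0)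
    (hpos : ∀ t ∈ Ioo a b, 0 < d t → 0 < t * d2 t + d1 t) {t : ℝ} (ht : t ∈ Icc a b) :
    d t ≤ 0 := by
  obtain ⟨s, hs, hmax⟩ := isCompact_Icc.exists_isMaxOn ⟨t, ht⟩ hd
  refine (hmax ht).trans ?_
  by_contra! hds
  have hs' : s ∈ Ioo a b := by
    refine ⟨hs.1.lt_of_ne ?_, hs.2.lt_of_ne ?_⟩
    · rintro rfl; exact absurd hds (not_lt.2 hda)
    · rintro rfl; exact absurd hds (not_lt.2 hdb)
  have hloc : IsLocalMax d s := hmax.isLocalMax (Icc_mem_nhds hs'.1 hs'.2)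
  have h1 := hloc.hasDerivAt_eq_zero (hd1 s hs')
  have h2 := second_deriv_nonpos_of_isLocalMax
    (by filter_upwards [Ioo_mem_nhds hs'.1 hs'.2] with y hy using hd1 y hy) (hd2 s hs') hloc
  have h3 := hpos s hs' hds
  have h4 : s * d2 s ≤ 0 := mul_nonpos_of_nonneg_of_nonpos (ha.trans hs'.1).le h2
  linarith

/-- Landau's interpolation inequality on an interval. -/
lemma abs_deriv_le_of_abs_le {a b A B h : ℝ} {f f1 f2 : ℝ → ℝ}
    (hf1 : ∀ t ∈ Icc a b, HasDerivWithinAt f (f1 t) (Icc a b) t)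
    (hf2 : ∀ t ∈ Icc a b, HasDerivWithinAt f1 (f2 t) (Icc a b) t)
    (hA : ∀ t ∈ Icc a b, |f t| ≤ A) (hB : ∀ t ∈ Icc a b, |f2 t| ≤ B) (hh : 0 < h)
    (hhab : h ≤ (b - a) / 2) {t : ℝ} (ht : t ∈ Icc a b) : |f1 t| ≤ 2 * A / h + B * h := by
  obtain ⟨x, hx, hxt⟩ : ∃ x, Icc x (x + h) ⊆ Icc a b ∧ t ∈ Icc x (x + h) := by
    rcases le_total t ((a + b) / 2) with h1 | h1
    · exact ⟨t, Icc_subset_Icc ht.1 (by linarith), by simp [hh.le]⟩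
    · exact ⟨t - h, Icc_subset_Icc (by linarith) (by linarith [ht.2]), by simp [hh.le]⟩
  have hB0 : 0 ≤ B := (abs_nonneg _).trans (hB t ht)
  obtain ⟨ξ, hξ, hξe⟩ := exists_hasDerivAt_eq_slope f f1 (show x < x + h by linarith)
    (fun s hs => (hf1 s (hx hs)).continuousWithinAt.mono hx)
    fun s hs => (((hf1 s (hx (Ioo_subset_Icc_self hs))).mono hx).hasDerivAt
      (Icc_mem_nhds hs.1 hs.2))
  have hξ' := hx (Ioo_subset_Icc_self hξ)
  have h1 : |f1 ξ| ≤ 2 * A / h := by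
    rw [hξe, add_sub_cancel_left, abs_div, abs_of_pos hh]
    gcongr
    have := abs_sub (f (x + h)) (f x)
    have := hA x (hx ⟨le_rfl, by linarith⟩)
    have := hA (x + h) (hx ⟨by linarith, le_rfl⟩)
    linarith
  have h2 : |f1 t - f1 ξ| ≤ B * |t - ξ| :=
    (convex_Icc a b).norm_image_sub_le_of_norm_hasDerivWithin_le hf2 hB hξ' ht
  have h3 : |t - ξ| ≤ h := by
    rw [abs_le]; constructor <;> linarith [hxt.1, hxt.2, hξ.1, hξ.2]
  have h4 : B * |t - ξ| ≤ B * h := by gcongr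
  have h5 := abs_sub_abs_le_abs_sub (f1 t) (f1 ξ)
  linarith

/-- The difference of a profile from the singular solution `(1/4) log t`. -/
noncomputable def profileDiff (g : ℝ → ℝ) (t : ℝ) : ℝ := g t - 1 / 4 * Real.log t

namespace IsProfile

variable {T c ε : ℝ} {g : ℝ → ℝ}

lemma profileDiff_nonneg (h : IsProfile T c g) {t : ℝ} (ht : t ∈ Ioc 0 T) :
    0 ≤ profileDiff g t := by
  have := (sqrt_le_exp_iff ht.1).1 (h.sqrt_le t ⟨ht.1.le, ht.2⟩)
  unfold profileDiff; linarith

/-- The linear lower bound `e^{2g} - t e^{-2g} = 2 √t sinh (2 V) ≥ 4 √t V`, where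
`V = g - (1/4) log t`. -/
lemma le_source (h : IsProfile T c g) (hc : 0 < c) {t : ℝ} (ht : t ∈ Ioc 0 T) :
    4 * c * √t * profileDiff g t ≤ source c t (g t) := by
  have h0 := h.profileDiff_nonneg ht
  have hst := Real.sqrt_pos.2 ht.1
  set V := profileDiff g t with hV
  have hg : g t = V + 1 / 4 * Real.log t := by rw [hV, profileDiff]; ring
  have h1 : Real.exp (2 * g t) = √t * Real.exp (2 * V) := by
    rw [hg, mul_add, Real.exp_add, exp_half_log ht.1, mul_comm]
  have h2 : t * Real.exp (-2 * g t) = √t * Real.exp (-(2 * V)) := by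
    rw [show -2 * g t = -(2 * g t) by ring, Real.exp_neg, h1, Real.exp_neg, mul_inv, ← mul_assoc]
    congr 1
    rw [← div_eq_mul_inv, Real.div_sqrt]
  have h3 : 2 * V ≤ Real.sinh (2 * V) := Real.self_le_sinh_iff.2 (by linarith)
  rw [Real.sinh_eq] at h3
  have h4 : 4 * V ≤ Real.exp (2 * V) - Real.exp (-(2 * V)) := by linarith
  rw [source, h1, h2, ← mul_sub]
  calc 4 * c * √t * V = c * (√t * (4 * V)) := by ring
    _ ≤ _ := by gcongr

/-- Comparison with the barrier `exp (-μ (t - T/16))`, where `T μ² = 4 c √(T/16)`. -/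
lemma profileDiff_le_exp (h : IsProfile T (coef ε) g) (hT : 0 < T) (hε : 0 < ε) {t : ℝ}
    (ht : t ∈ Icc (T / 16) T) :
    profileDiff g t ≤ Real.exp (-(Real.pi * √(√T / T) / ε * (t - T / 16))) := by
  have hc := coef_pos hε
  have hu := uniqueDiffOn_Icc hT
  have ha : 0 < T / 16 := by positivity
  have hsT := Real.sqrt_pos.2 hT
  set μ := Real.pi * √(√T / T) / ε with hμ
  have hμ0 : 0 < μ := by have := Real.pi_pos; positivity
  have hμ2 : T * μ ^ 2 = coef ε * √T := by
    rw [hμ, div_pow, mul_pow, Real.sq_sqrt (by positivity), coef]; field_simp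
  set B : ℝ → ℝ := fun t => Real.exp (-(μ * (t - T / 16))) with hB
  have hBd : ∀ t, HasDerivAt B (-μ * B t) t := fun t => by
    have := ((((hasDerivAt_id t).sub_const (T / 16)).const_mul μ).neg).exp
    refine this.congr_deriv ?_
    simp [hB]; ring
  set g1 := iteratedDerivWithin 1 g (Icc 0 T)
  set g2 := iteratedDerivWithin 2 g (Icc 0 T)
  have hIcc : ∀ s ∈ Ioo (T / 16) T, s ∈ Icc 0 T := fun s hs => ⟨(ha.trans hs.1).le, hs.2.le⟩
  have hg1 : ∀ s ∈ Ioo (T / 16) T, HasDerivAt g (g1 s) s := fun s hs => by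
    have := hasDerivWithinAt_iteratedDerivWithin hu h.contDiffOn 0 (hIcc s hs)
    rw [iteratedDerivWithin_zero] at this
    exact this.hasDerivAt (Icc_mem_nhds (ha.trans hs.1) hs.2)
  have hg2 : ∀ s ∈ Ioo (T / 16) T, HasDerivAt g1 (g2 s) s := fun s hs =>
    (hasDerivWithinAt_iteratedDerivWithin hu h.contDiffOn 1 (hIcc s hs)).hasDerivAt
      (Icc_mem_nhds (ha.trans hs.1) hs.2)
  have hVc : ContinuousOn (profileDiff g) (Icc (T / 16) T) :=
    (h.contDiffOn.continuousOn.mono (Icc_subset_Icc_left ha.le)).sub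
      (continuousOn_const.mul (Real.continuousOn_log.mono fun t ht => (ha.trans_le ht.1).ne'))
  have key := nonpos_of_operator_pos ha (d := fun t => profileDiff g t - B t)
    (d1 := fun t => g1 t - 1 / 4 * t⁻¹ - -μ * B t)
    (d2 := fun t => g2 t - 1 / 4 * -(t ^ 2)⁻¹ - -μ * (-μ * B t))
    (hVc.sub (by fun_prop : Continuous B).continuousOn)
    (fun s hs => ((hg1 s hs).sub ((Real.hasDerivAt_log (ha.trans hs.1).ne').const_mul _)).sub
      (hBd s))
    (fun s hs => ((hg2 s hs).sub ((hasDerivAt_inv (ha.trans hs.1).ne').const_mul _)).sub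
      ((hBd s).const_mul _)) ?_ ?_ ?_ ht
  · simpa [sub_nonpos] using key
  · have h1 := h.monotoneOn hc ⟨ha.le, by linarith⟩ ⟨hT.le, le_rfl⟩ (by linarith : T / 16 ≤ T)
    have h2 : Real.log (T / 16) = Real.log T - 4 * Real.log 2 := by
      rw [Real.log_div hT.ne' (by norm_num), show (16 : ℝ) = 2 ^ 4 by norm_num, Real.log_pow]
      norm_num
    have h3 := Real.log_two_lt_d9
    have h4 : B (T / 16) = 1 := by simp [hB]
    rw [h4, profileDiff, h2]
    rw [h.boundary] at h1
    linarith
  · rw [profileDiff, h.boundary, sub_self, zero_sub, neg_nonpos]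
    exact (Real.exp_pos _).le
  · intro s hs hpos
    have hs0 := ha.trans hs.1
    have hode := h.mul_iteratedDerivWithin hT 0 (hIcc s hs)
    simp only [zero_add, Nat.cast_zero, one_mul, iteratedDerivWithin_zero] at hode
    change s * g2 s + g1 s = _ at hode
    have hsrc := h.le_source hc ⟨hs0, hs.2.le⟩
    rw [← hode] at hsrc
    have hB0 : 0 < B s := Real.exp_pos _
    have h1 : √T / 4 ≤ √s := by
      refine Real.le_sqrt_of_sq_le ?_
      rw [div_pow, Real.sq_sqrt hT.le]; linarith [hs.1]
    have h2 : coef ε * √T * profileDiff g s ≤ 4 * coef ε * √s * profileDiff g s := by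
      have := h.profileDiff_nonneg ⟨hs0, hs.2.le⟩
      calc coef ε * √T * profileDiff g s = 4 * coef ε * (√T / 4) * profileDiff g s := by ring
        _ ≤ _ := by gcongr
    have h3 : coef ε * √T * B s < coef ε * √T * profileDiff g s := by
      have : B s < profileDiff g s := by linarith
      gcongr
    have h4 : s * (μ ^ 2 * B s) ≤ coef ε * √T * B s := by
      rw [← hμ2, ← mul_assoc]; have := hs.2.le; gcongr
    have h5 : s * (1 / 4 * -(s ^ 2)⁻¹) + 1 / 4 * s⁻¹ = 0 := by field_simp; ring
    have h6 := mul_pos hμ0 hB0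
    nlinarith

end IsProfile

/-- Near the boundary the profile is `O(ε^∞)`-close to the singular solution. -/
theorem exists_profileDiff_le {T : ℝ} (hT : 0 < T) (N : ℕ) :
    ∃ C : ℝ, 0 < C ∧ ∀ ε : ℝ, 0 < ε → ∀ g : ℝ → ℝ, IsProfile T (coef ε) g →
      ∀ t ∈ Icc (T / 4) T, |profileDiff g t| ≤ C * ε ^ N := by
  have hκ : 0 < Real.pi * √(√T / T) * (T / 8) := by have := Real.pi_pos; positivity
  set κ := Real.pi * √(√T / T) * (T / 8) with hκd
  refine ⟨N.factorial / κ ^ N, by positivity, fun ε hε g hg t ht => ?_⟩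
  rw [abs_of_nonneg (hg.profileDiff_nonneg ⟨by linarith [ht.1], ht.2⟩)]
  refine (hg.profileDiff_le_exp hT hε ⟨by linarith [ht.1], ht.2⟩).trans ?_
  have h1 : κ / ε ≤ Real.pi * √(√T / T) / ε * (t - T / 16) := by
    rw [hκd, div_mul_eq_mul_div]
    have := Real.pi_pos
    have : T / 8 ≤ t - T / 16 := by linarith [ht.1]
    gcongr
  have h2 := Real.pow_div_factorial_le_exp (κ / ε) (by positivity) N
  calc Real.exp (-(Real.pi * √(√T / T) / ε * (t - T / 16))) ≤ Real.exp (-(κ / ε)) := by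
        rw [Real.exp_le_exp]; linarith
    _ = (Real.exp (κ / ε))⁻¹ := Real.exp_neg _
    _ ≤ ((κ / ε) ^ N / N.factorial)⁻¹ := inv_anti₀ (by positivity) h2
    _ = _ := by rw [inv_div, div_pow]; field_simp

/-! ### Decay of all derivatives and the theorem -/

lemma contDiffOn_log_Icc {a b : ℝ} (ha : 0 < a) : ContDiffOn ℝ ∞ Real.log (Icc a b) :=
  Real.contDiffOn_log.mono fun _ ht => (ha.trans_le ht.1).ne'

lemma exists_abs_iteratedDerivWithin_le {f : ℝ → ℝ} {a b : ℝ} (hab : a < b)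
    (hf : ContDiffOn ℝ ∞ f (Icc a b)) (n : ℕ) :
    ∃ C : ℝ, 0 < C ∧ ∀ t ∈ Icc a b, |iteratedDerivWithin n f (Icc a b) t| ≤ C := by
  obtain ⟨C, hC⟩ := isCompact_Icc.exists_bound_of_continuousOn
    (hf.continuousOn_iteratedDerivWithin (m := n) (by exact_mod_cast le_top)
      (uniqueDiffOn_Icc hab))
  exact ⟨max C 1, by positivity, fun t ht => (hC t ht).trans (le_max_left _ _)⟩

lemma IsProfile.contDiffOn_profileDiff {T c : ℝ} {g : ℝ → ℝ} (hT : 0 < T) (h : IsProfile T c g) :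
    ContDiffOn ℝ ∞ (profileDiff g) (Icc (T / 4) T) :=
  (h.contDiffOn.mono (Icc_subset_Icc_left (by positivity))).sub
    (contDiffOn_const.mul (contDiffOn_log_Icc (by positivity)))

/-- The derivatives of `profileDiff` grow at most polynomially in `ε⁻¹`. -/
lemma exists_iteratedDerivWithin_profileDiff_le_inv {T : ℝ} (hT : 0 < T) (n : ℕ) :
    ∃ C : ℝ, 0 < C ∧ ∀ ε : ℝ, 0 < ε → ε ≤ 1 → ∀ g : ℝ → ℝ, IsProfile T (coef ε) g →
      ∀ t ∈ Icc (T / 4) T,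
        |iteratedDerivWithin (n + 1) (profileDiff g) (Icc (T / 4) T) t| ≤
          C * (ε ^ (2 * (n + 1)))⁻¹ := by
  obtain ⟨C, hC, hCb⟩ := exists_iteratedDerivWithin_profile_le hT (n + 1)
  have hT4 : T / 4 < T := by linarith
  have hlog : ContDiffOn ℝ ∞ (fun t => 1 / 4 * Real.log t) (Icc (T / 4) T) :=
    contDiffOn_const.mul (contDiffOn_log_Icc (by positivity))
  obtain ⟨L, hL, hLb⟩ := exists_abs_iteratedDerivWithin_le hT4 hlog (n + 1)
  have hu := uniqueDiffOn_Icc hT4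
  have hle : (((n + 1 : ℕ)) : ℕ∞ω) ≤ ∞ := by exact_mod_cast le_top
  refine ⟨C ^ (n + 1) + L, by positivity, fun ε hε hε1 g hg t ht => ?_⟩
  have hsub : Icc (T / 4) T ⊆ Icc 0 T := Icc_subset_Icc_left (by positivity)
  have h1 : iteratedDerivWithin (n + 1) (profileDiff g) (Icc (T / 4) T) t =
      iteratedDerivWithin (n + 1) g (Icc (T / 4) T) t -
        iteratedDerivWithin (n + 1) (fun t => 1 / 4 * Real.log t) (Icc (T / 4) T) t :=
    iteratedDerivWithin_sub ht hu (((hg.contDiffOn.mono hsub).of_le hle) t ht)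
      ((hlog.of_le hle) t ht)
  have h2 : iteratedDerivWithin (n + 1) g (Icc (T / 4) T) t =
      iteratedDerivWithin (n + 1) g (Icc 0 T) t := by
    rw [iteratedDerivWithin, iteratedDerivWithin,
      iteratedFDerivWithin_subset hsub hu (uniqueDiffOn_Icc hT) (hg.contDiffOn.of_le hle) ht]
  have h3 := hCb ε hε hε1 g hg t (hsub ht) (n + 1) (by omega) le_rfl
  have h4 : (C / (ε * max √t ε)) ^ (n + 1) ≤ C ^ (n + 1) * (ε ^ (2 * (n + 1)))⁻¹ := by
    rw [pow_mul, ← div_eq_mul_inv, ← div_pow]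
    have : ε ^ 2 ≤ ε * max √t ε := by rw [sq]; gcongr; exact le_max_right _ _
    gcongr
  have h5 : L ≤ L * (ε ^ (2 * (n + 1)))⁻¹ :=
    le_mul_of_one_le_right hL.le ((one_le_inv₀ (by positivity)).2 (pow_le_one₀ hε.le hε1))
  have h6 := hLb t ht
  rw [h1, h2, add_mul]
  refine (abs_sub _ _).trans ?_
  linarith

/-- All derivatives of `profileDiff g` are `O(ε^∞)`: they grow at most polynomially in `ε⁻¹`,
and the function itself is `O(ε^∞)`, so Landau's inequality applies. -/
theorem exists_iteratedDerivWithin_profileDiff_le {T : ℝ} (hT : 0 < T) (k N : ℕ) :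
    ∃ C : ℝ, 0 < C ∧ ∀ ε : ℝ, 0 < ε → ε ≤ 1 → ∀ g : ℝ → ℝ, IsProfile T (coef ε) g →
      ∀ t ∈ Icc (T / 4) T,
        |iteratedDerivWithin k (profileDiff g) (Icc (T / 4) T) t| ≤ C * ε ^ N := by
  have hT4 : T / 4 < T := by linarith
  have hu := uniqueDiffOn_Icc hT4
  induction k generalizing N with
  | zero =>
    obtain ⟨C, hC, hCb⟩ := exists_profileDiff_le hT N
    exact ⟨C, hC, fun ε hε _ g hg t ht => by
      rw [iteratedDerivWithin_zero]; exact hCb ε hε g hg t ht⟩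
  | succ k ih =>
    obtain ⟨B, hB, hBb⟩ := exists_iteratedDerivWithin_profileDiff_le_inv hT (k + 1)
    set M := 2 * (k + 1 + 1)
    obtain ⟨A, hA, hAb⟩ := ih (2 * N + M)
    refine ⟨2 * A / (T / 4) + B * (T / 4), by positivity, fun ε hε hε1 g hg t ht => ?_⟩
    have hV := hg.contDiffOn_profileDiff hT
    -- this step length balances the two terms of the interpolation inequality
    have hle : T / 4 * ε ^ (N + M) ≤ (T - T / 4) / 2 := by
      have : T / 4 * ε ^ (N + M) ≤ T / 4 * 1 := by
        gcongr; exact pow_le_one₀ hε.le hε1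
      linarith
    refine (abs_deriv_le_of_abs_le (h := T / 4 * ε ^ (N + M))
      (fun s hs => hasDerivWithinAt_iteratedDerivWithin hu hV k hs)
      (fun s hs => hasDerivWithinAt_iteratedDerivWithin hu hV (k + 1) hs)
      (hAb ε hε hε1 g hg) (hBb ε hε hε1 g hg) (by positivity) hle ht).trans (le_of_eq ?_)
    rw [show 2 * N + M = N + (N + M) by ring, pow_add ε N (N + M)]
    have : ε ^ (N + M) ≠ 0 := by positivity
    field_simp
    rw [pow_add]; ring

theorem exists_supNormOn_radialDifference_le {r₀ : ℝ} (hr₀ : 0 < r₀) (k N : ℕ) :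
    ∃ C : ℝ, 0 < C ∧ ∀ ε : ℝ, 0 < ε → ε ≤ 1 → ∀ g : ℝ → ℝ,
      IsProfile ((2 * r₀) ^ 2) (coef ε) g →
      supNormOn (Icc r₀ (2 * r₀)) (iteratedDerivWithin k
        (radialDifference fun x : Plane => g (‖x‖ ^ 2)) (Icc r₀ (2 * r₀))) ≤
        ENNReal.ofReal (C * ε ^ N) := by
  set T := (2 * r₀) ^ 2 with hTd
  have hT : 0 < T := by positivity
  have hT4 : T / 4 < T := by linarith
  have hr : r₀ < 2 * r₀ := by linarith
  have hu := uniqueDiffOn_Icc hr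
  have hsq : ContDiff ℝ ∞ fun r : ℝ => r ^ 2 := contDiff_id.pow 2
  choose C hC hCb using fun i => exists_iteratedDerivWithin_profileDiff_le hT i N
  choose D hD hDb using fun i => exists_abs_iteratedDerivWithin_le hr hsq.contDiffOn i
  set C' := ∑ i ∈ Finset.range (k + 1), C i
  set D' := 1 + ∑ i ∈ Finset.range (k + 1), D i
  have hC' : 0 < C' := Finset.sum_pos (fun i _ => hC i) (by simp)
  have hD' : 1 ≤ D' := le_add_of_nonneg_right (Finset.sum_nonneg fun i _ => (hD i).le)
  refine ⟨k.factorial * C' * D' ^ k, by positivity, fun ε hε hε1 g hg => ?_⟩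
  have hmaps : MapsTo (fun r : ℝ => r ^ 2) (Icc r₀ (2 * r₀)) (Icc (T / 4) T) := fun r hr => by
    have h1 := pow_le_pow_left₀ hr₀.le hr.1 2
    have h2 := pow_le_pow_left₀ (hr₀.le.trans hr.1) hr.2 2
    exact ⟨by rw [hTd]; linarith, h2⟩
  have hfun : radialDifference (fun x : Plane => g (‖x‖ ^ 2)) =
      profileDiff g ∘ fun r : ℝ => r ^ 2 := by
    funext r
    simp only [radialDifference, radialProfile, profileDiff, Function.comp, PiLp.norm_single,
      Real.norm_eq_abs, sq_abs, Real.log_pow]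
    push_cast; ring
  refine iSup₂_le fun r hr' => ?_
  rw [← ofReal_norm]
  refine ENNReal.ofReal_le_ofReal ?_
  rw [hfun, ← norm_iteratedFDerivWithin_eq_norm_iteratedDerivWithin]
  refine (norm_iteratedFDerivWithin_comp_le (N := ∞) (C := C' * ε ^ N) (D := D')
    (hg.contDiffOn_profileDiff hT) hsq.contDiffOn (by exact_mod_cast le_top)
    (uniqueDiffOn_Icc hT4) hu hmaps hr' (fun i hi => ?_) fun i h1 hi => ?_).trans
    (le_of_eq (by ring))
  · rw [norm_iteratedFDerivWithin_eq_norm_iteratedDerivWithin]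
    refine (hCb i ε hε hε1 g hg _ (hmaps hr')).trans ?_
    have : C i ≤ C' := Finset.single_le_sum (fun i _ => (hC i).le)
      (Finset.mem_range.2 (Nat.lt_succ_of_le hi))
    gcongr
  · rw [norm_iteratedFDerivWithin_eq_norm_iteratedDerivWithin]
    refine (hDb i r hr').trans ?_
    have : D i ≤ ∑ i ∈ Finset.range (k + 1), D i := Finset.single_le_sum (fun i _ => (hD i).le)
      (Finset.mem_range.2 (Nat.lt_succ_of_le hi))
    exact (by linarith : D i ≤ D').trans (le_self_pow₀ hD' (by omega))

theorem mainTheorem3 (r₀ : ℝ) (hr₀ : 0 < r₀) :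
    ∃ u : ℝ → Plane → ℝ,
      (∀ ε : ℝ, 0 < ε →
        IsClassicalSolution r₀ ε (u ε) ∧
        ContDiffOn ℝ ∞ (u ε) (Metric.closedBall 0 (2 * r₀)) ∧
        IsRadialOn (u ε) (Metric.closedBall 0 (2 * r₀)) ∧
        ∀ w : Plane → ℝ, IsClassicalSolution r₀ ε w →
          Set.EqOn w (u ε) (Metric.closedBall 0 (2 * r₀))) ∧
      (∀ l k : ℕ, k < l → ∃ C : ℝ, 0 < C ∧ ∀ ε : ℝ, 0 < ε → ε < 1 / 8 →
        supNormOn (Set.Icc r₀ (2 * r₀))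
            (iteratedDerivWithin k (radialDifference (u ε)) (Set.Icc r₀ (2 * r₀))) <
          ENNReal.ofReal (C * ε ^ (l - k))) ∧
      (∀ k : ℕ, ∀ R : ℝ, 0 < R → R ≤ 2 * r₀ → ∃ C : ℝ, 0 < C ∧ ∀ ε : ℝ, 0 < ε → ε < 1 / 8 →
        ckNorm k (Metric.ball 0 R) (u ε) ≤ ENNReal.ofReal (C * ε ^ (-(k : ℤ) - 2))) := by
  have hR : 0 < 2 * r₀ := by positivity
  have hex : ∀ ε : ℝ, ∃ g : ℝ → ℝ, 0 < ε → IsProfile ((2 * r₀) ^ 2) (coef ε) g := fun ε => by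
    by_cases hε : 0 < ε
    · obtain ⟨g, hg⟩ := exists_isProfile (T := (2 * r₀) ^ 2) (by positivity) (coef_pos hε)
      exact ⟨g, fun _ => hg⟩
    · exact ⟨0, fun h => absurd h hε⟩
  choose g hg using hex
  refine ⟨fun ε x => g ε (‖x‖ ^ 2), fun ε hε => ?_, fun l k _ => ?_, fun k R _ hR' => ?_⟩
  · have hsol := (hg ε hε).isClassicalSolution hr₀
    refine ⟨hsol, (hg ε hε).contDiffOn_comp_norm_sq, fun x _ y _ hxy => ?_, fun w hw x hx => ?_⟩
    · simp only [hxy]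
    · exact le_antisymm (hw.le hε hsol hx) (hsol.le hε hw hx)
  · obtain ⟨C, hC, hCb⟩ := exists_supNormOn_radialDifference_le hr₀ k (l - k)
    refine ⟨C + 1, by positivity, fun ε hε hε8 => ?_⟩
    refine (hCb ε hε (by linarith) _ (hg ε hε)).trans_lt ?_
    rw [ENNReal.ofReal_lt_ofReal_iff (by positivity)]
    have : 0 < ε ^ (l - k) := by positivity
    linarith
  · obtain ⟨C, hC, hCb⟩ := exists_ckNorm_profile_le hR k
    exact ⟨C, hC, fun ε hε hε8 => (ckNorm_mono (Metric.ball_subset_ball hR') _).trans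
      (hCb ε hε (by linarith) _ (hg ε hε))⟩
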